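/- **Terms.** Terms of the value substitution kernel $\lambda_{vker}$ are $t,s,u ::= x \mid \lambda x.t \mid v\,s \mid t[x/u]$ with values $v ::= x \mid \lambda x.t$; both $\lambda x.t$ and $t[x/u]$ bind $x$ in $t$, and $\mathrm{fv}(t)$ is the set of free variables of $t$. **Hypergraphs.** Nodes are of type $e$ or $m$. Links are directed hyperedges of the kinds: $!$ (from an $e$-node to an $m$-node); $\mathsf d$ (from an $m$-node to an $e$-node); $\mathsf w$ (no source, target an $e$-node); $\parr$ (sources an $m$-node and an $e$-node, its *variable*; target an $e$-node); $\otimes$ (from an $e$-node to an $m$-node and an $e$-node). A *source* (*target*) of a hypergraph is a node without incoming (outgoing) links; a node that is neither is *internal*. **Nets.** A net $G$ is a finite hypergraph of such links without isolated nodes, with a root $r_G$ and, for every $\parr$-link $l$ of $G$, a box $\mathrm{box}(l)$, such that: (1) $r_G$ is an $e$-node and a source of $G$; (2) every target of $G$ is an $e$-node that is the target of $\mathsf d$- and $\mathsf w$-links only; these targets form the set $\mathrm{fv}(G)$ of free variables of $G$; (3) every $m$-node has exactly one incoming and exactly one outgoing link; (4) every $e$-node has at most one outgoing link, and if it has more than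 one incoming link then all of these are $\mathsf d$-links; (5) for every $\parr$-link $l$ with variable $x$ and target $r$, the box of $l$ is a sub-hypergraph of $G$ which, with the boxes inherited from $G$, is a net with root $r$ and $x\in\mathrm{fv}(\mathrm{box}(l))$, and no free variable $\neq x$ of $\mathrm{box}(l)$ is the target of a $\mathsf w$-link of $\mathrm{box}(l)$; (6) if two boxes share a node and neither contains the other, then every shared node is a free variable of both; (7) every link of $G$ whose target is an internal $e$-node of $\mathrm{box}(l)$, or is the variable $x$ of $l$, lies in $\mathrm{box}(l)$. A *free weakening* of $G$ is a $\mathsf w$-link whose target is in $\mathrm{fv}(G)$. **Correctness.** The correction graph $G^0$ is obtained from $G$ by collapsing every $\parr$-link $l$ that lies in no box, together with its box, into one link from the $m$-node of $l$ to all free variables of $\mathrm{box}(l)$ other than the variable of $l$. The net $G$ is *correct* if $r_G$ is the one and only $e$-node of $G^0$ that is a source of $G^0$, $G^0$ has no directed cycle, and every box of $G$ is correct. **Translation.** Names of $e$-nodes and names of variables coincide. The net $[\![t]\!]_X$, for a finite set $X$ of variables, is determined up to the choice of fresh names for its $m$-nodes, its root and the roots of the subterms that are not already named below by: * $[\![x]\!]_\emptyset$: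 a $!$-link from the root to an $m$-node $a$, and a $\mathsf d$-link from $a$ to $x$; * $[\![\lambda x.t]\!]_\emptyset$: a $!$-link from the root to an $m$-node $a$, and a $\parr$-link with $m$-source $a$, variable $x$, box $[\![t]\!]_{\{x\}}$ and target the root of that box; * $[\![y\,s]\!]_\emptyset$: $[\![s]\!]_\emptyset$, with a $\otimes$-link from the new root to a new $m$-node $a$ and the root of $[\![s]\!]_\emptyset$, and a $\mathsf d$-link from $a$ to $y$; * $[\![(\lambda x.t)\,s]\!]_\emptyset$: the same with the $\mathsf d$-link replaced by a $\parr$-link with $m$-source $a$, variable $x$, box $[\![t]\!]_{\{x\}}$ and target the root of that box; * $[\![t[x/u]]\!]_\emptyset$: the union of $[\![t]\!]_{\{x\}}$ and $[\![u]\!]_\emptyset$, where the node $x$ is the root of $[\![u]\!]_\emptyset$ and the root is that of $[\![t]\!]_{\{x\}}$; * $[\![t]\!]_{X\cup\{y\}}$ is $[\![t]\!]_X$ if $y\in\mathrm{fv}(t)$, and $[\![t]\!]_X$ with a $\mathsf w$-link on the node $y$, new in it, if $y\notin\mathrm{fv}(t)$. Here the nets of two subterms share no nodes other than common free variables and, in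 the clause for $t[x/u]$, the node $x$. Bound variables are thus chosen distinct from each other and from the free ones. A *proof net* is a net of the form $[\![t]\!]_X$. **Theorem (sequentialization).** Let $G$ be a correct net and let $X$ be the set of $e$-nodes of its free weakenings. Then there is a term $t$ of $\lambda_{vker}$ with $[\![t]\!]_X = G$ and $\mathrm{fv}(G)=\mathrm{fv}(t)\cup X$; in particular $G$ is a proof net. Conversely, for every term $t$ and every finite set $X$ of variables, each $[\![t]\!]_X$ is a correct net. Hence a net is correct if and only if it is a proof net. -/

import Mathlib

/-! ### Terms of the value substitution kernel -/

/-- Terms of the value substitution kernel,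
`t, s, u ::= x ∣ λ x. t ∣ v s ∣ t[x/u]` with values `v ::= x ∣ λ x. t`.
Since the left subterm of an application is a value, the clause `v s` is split into
the two cases `x s` and `(λ x. t) s`. -/
inductive Term (V : Type*) where
  /-- `x` -/
  | var (x : V) : Term V
  /-- `λ x. t` -/
  | lam (x : V) (t : Term V) : Term V
  /-- `x s` -/
  | varApp (x : V) (s : Term V) : Term V
  /-- `(λ x. t) s` -/
  | lamApp (x : V) (t s : Term V) : Term V
  /-- the explicit substitution `t[x/u]`, which binds `x` in `t` -/
  | sub (t : Term V) (x : V) (u : Term V) : Term V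

/-- The free variables of a term. -/
def Term.fv {V : Type*} : Term V → Set V
  | .var x => {x}
  | .lam x t => t.fv \ {x}
  | .varApp x s => {x} ∪ s.fv
  | .lamApp x t s => (t.fv \ {x}) ∪ s.fv
  | .sub t x u => (t.fv \ {x}) ∪ u.fv

/-! ### Directed labelled hypergraphs -/

/-- Nodes of type `e` (exponential), named by `E`, and of type `m` (multiplicative), named by
`M`. -/
inductive Node (E M : Type*) where
  | e (x : E) : Node E M
  | m (a : M) : Node E M

/-- Links (directed hyperedges). The label forces the number and the types of the sources and
targets. The `□`-links do not occur in nets, only in correction graphs. -/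
inductive Link (E M : Type*) where
  /-- `!` : from the e-node `x` to the m-node `a` -/
  | bang (x : E) (a : M) : Link E M
  /-- dereliction `d` : from the m-node `a` to the e-node `x` -/
  | der (a : M) (x : E) : Link E M
  /-- weakening `w` : no source, target the e-node `x` -/
  | weak (x : E) : Link E M
  /-- `⅋` : sources the m-node `a` and the e-node `x` (its variable), target the e-node `r`
  (the root of its box) -/
  | par (a : M) (x r : E) : Link E M
  /-- `⊗` : from the e-node `x` to the m-node `a` and the e-node `y` -/
  | tens (x : E) (a : M) (y : E) : Link E M
  /-- `□` : from the m-node `a` to the e-nodes in `T` -/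
  | square (a : M) (T : Set E) : Link E M

namespace Link

variable {E M : Type*}

/-- The sources of a link. -/
def src : Link E M → Set (Node E M)
  | bang x _ => {.e x}
  | der a _ => {.m a}
  | weak _ => ∅
  | par a x _ => {.m a, .e x}
  | tens x _ _ => {.e x}
  | square a _ => {.m a}

/-- The targets of a link. -/
def tgt : Link E M → Set (Node E M)
  | bang _ a => {.m a}
  | der _ x => {.e x}
  | weak x => {.e x}
  | par _ _ r => {.e r}
  | tens _ a y => {.m a, .e y}
  | square _ T => Node.e '' T

end Link

/-! A hypergraph without isolated nodes is given by its set of links. -/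
namespace Hyper

variable {E M : Type*}

/-- The nodes of the hypergraph with links `L`. -/
def nodes (L : Set (Link E M)) : Set (Node E M) := {u | ∃ l ∈ L, u ∈ l.src ∨ u ∈ l.tgt}

/-- `u` has an incoming link in `L`, that is, `u` is not a source of the hypergraph. -/
def HasIn (L : Set (Link E M)) (u : Node E M) : Prop := ∃ l ∈ L, u ∈ l.tgt

/-- `u` has an outgoing link in `L`, that is, `u` is not a target of the hypergraph. -/
def HasOut (L : Set (Link E M)) (u : Node E M) : Prop := ∃ l ∈ L, u ∈ l.src

/-- The internal nodes: neither a source nor a target of the hypergraph. -/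
def Internal (L : Set (Link E M)) (u : Node E M) : Prop := HasIn L u ∧ HasOut L u

/-- The conclusions, or free variables: the e-nodes that are targets of the hypergraph. -/
def fv (L : Set (Link E M)) : Set E := {x | .e x ∈ nodes L ∧ ¬ HasOut L (.e x)}

/-- The e-nodes of the free weakenings: the weakenings whose node is a free variable. -/
def freeWeakenings (L : Set (Link E M)) : Set E := {x | Link.weak x ∈ L ∧ x ∈ fv L}

/-- There is a path of length `1` from `u` to `v`. -/
def Step (L : Set (Link E M)) (u v : Node E M) : Prop := ∃ l ∈ L, u ∈ l.src ∧ v ∈ l.tgt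

/-- There is no cycle, i.e. no path of positive length from a node to itself. -/
def Acyclic (L : Set (Link E M)) : Prop := ∀ u, ¬ Relation.TransGen (Step L) u u

end Hyper

/-! ### Nets and correctness -/

section Nets

variable {E M : Type*}

open Hyper

/-- Let `B a x r` be the set of links of the box of the `⅋`-link with m-node `a`, variable `x` and
box root `r`. `IsNet B L r` says that the hypergraph with links `L`, the boxes given by `B`, and
the root `r`, is a net. A box is itself a net, whose `⅋`-links inherit their boxes. -/
inductive IsNet (B : M → E → E → Set (Link E M)) : Set (Link E M) → E → Prop where
  | intro (L : Set (Link E M)) (r : E)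
      (finite : L.Finite)
      (labels : ∀ a T, Link.square a T ∉ L)
      -- the root is a source of the net
      (root : Node.e r ∈ nodes L ∧ ¬ HasIn L (.e r))
      -- the free variables are targets of derelictions and weakenings only
      (conclusions : ∀ x ∈ fv L, ∀ l ∈ L, Node.e x ∈ l.tgt →
        (∃ a, l = .der a x) ∨ l = .weak x)
      (multiplicative : ∀ a, Node.m a ∈ nodes L →
        (∃! l, l ∈ L ∧ Node.m a ∈ l.tgt) ∧ (∃! l, l ∈ L ∧ Node.m a ∈ l.src))
      (exponential_out : ∀ x, ∀ l ∈ L, ∀ k ∈ L, Node.e x ∈ l.src → Node.e x ∈ k.src → l = k)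
      (exponential_in : ∀ x, ∀ l ∈ L, ∀ k ∈ L, Node.e x ∈ l.tgt → Node.e x ∈ k.tgt → l ≠ k →
        (∃ a, l = .der a x) ∧ (∃ b, k = .der b x))
      -- every box is a net whose root is the e-target of the `⅋`-link
      (box_net : ∀ a x s, Link.par a x s ∈ L → IsNet B (B a x s) s)
      (border : ∀ a x s, Link.par a x s ∈ L →
        x ∈ fv (B a x s) ∧ ∀ y ∈ fv (B a x s), y ≠ x → Link.weak y ∉ B a x s)
      (nesting : ∀ a x s b y q, Link.par a x s ∈ L → Link.par b y q ∈ L →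
        ¬ B a x s ⊆ B b y q → ¬ B b y q ⊆ B a x s →
        nodes (B a x s) ∩ nodes (B b y q) ⊆ Node.e '' (fv (B a x s) ∩ fv (B b y q)))
      -- the variable `x` of the `⅋`-link counts as internal to the box
      (internal_closure : ∀ a x s, Link.par a x s ∈ L →
        ∀ z, (Internal (B a x s) (.e z) ∨ z = x) → ∀ l ∈ L, Node.e z ∈ l.tgt → l ∈ B a x s)
      (subnet : ∀ a x s, Link.par a x s ∈ L → B a x s ⊆ L) :
      IsNet B L r

/-- The links at level `0`: those that are contained in no box. -/
def levelZero (B : M → E → E → Set (Link E M)) (L : Set (Link E M)) : Set (Link E M) :=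
  {l | l ∈ L ∧ ∀ a x r, Link.par a x r ∈ L → l ∉ B a x r}

/-- The correction graph: every `⅋`-link at level `0`, together with its box, is collapsed
into a `□`-link from the m-node of the `⅋`-link to the free variables of the box other than the
variable of the `⅋`-link. -/
def correctionGraph (B : M → E → E → Set (Link E M)) (L : Set (Link E M)) : Set (Link E M) :=
  {l | l ∈ levelZero B L ∧ ∀ a x r, l ≠ .par a x r} ∪
    {l | ∃ a x r, Link.par a x r ∈ levelZero B L ∧ l = .square a (fv (B a x r) \ {x})}

/-- Correctness of the net with links `L`, boxes `B` and root `r`. -/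
inductive IsCorrect (B : M → E → E → Set (Link E M)) : Set (Link E M) → E → Prop where
  | intro (L : Set (Link E M)) (r : E)
      -- the root is the one and only e-source of the correction graph
      (source : ∀ x, (Node.e x ∈ nodes (correctionGraph B L) ∧
        ¬ HasIn (correctionGraph B L) (.e x)) ↔ x = r)
      (acyclicity : Acyclic (correctionGraph B L))
      (recursive : ∀ a x s, Link.par a x s ∈ L → IsCorrect B (B a x s) s) :
      IsCorrect B L r

/-! ### The translation from terms to nets -/

/-- `Translates B t X L r` says that the net with links `L`, boxes `B` and root `r` is the
translation of the term `t` with respect to the set of variables `X`. Variable names and names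
of e-nodes coincide: the free and bound variables of `t` are e-nodes of the net, under their own
name. The root, the m-nodes and the bound variables are chosen fresh, so that the nets of two
subterms share nothing but free variables. -/
inductive Translates (B : M → E → E → Set (Link E M)) :
    Term E → Set E → Set (Link E M) → E → Prop where
  /-- `x`: a `!`-link on a dereliction. -/
  | var (x r : E) (a : M) (hr : r ≠ x) :
      Translates B (.var x) ∅ {.bang r a, .der a x} r
  /-- `λ x. t`: a `!`-link on a `⅋`-link, whose box is the net of `t` with respect to `{x}`. -/
  | lam (x r s : E) (a : M) (t : Term E) (L : Set (Link E M))
      (ht : Translates B t {x} L s)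
      (hbox : B a x s = L)
      (ha : Node.m a ∉ nodes L) (hr : Node.e r ∉ nodes L) :
      Translates B (.lam x t) ∅ ({.bang r a, .par a x s} ∪ L) r
  /-- `y s`: a `⊗`-link on a dereliction on `y` and on the root of the net of `s`. -/
  | varApp (y r q : E) (a : M) (s : Term E) (L : Set (Link E M))
      (hs : Translates B s ∅ L q)
      (ha : Node.m a ∉ nodes L) (hr : Node.e r ∉ nodes L) (hry : r ≠ y)
      (hy : Node.e y ∈ nodes L → y ∈ s.fv) :
      Translates B (.varApp y s) ∅ ({.tens r a q, .der a y} ∪ L) r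
  /-- `(λ x. t) s`: a `⊗`-link on a `⅋`-link, whose box is the net of `t` with respect to `{x}`,
  and on the root of the net of `s`. -/
  | lamApp (x r p q : E) (a : M) (t s : Term E) (K L : Set (Link E M))
      (ht : Translates B t {x} K p) (hs : Translates B s ∅ L q)
      (hbox : B a x p = K)
      (ha : Node.m a ∉ nodes K ∪ nodes L) (hr : Node.e r ∉ nodes K ∪ nodes L)
      (hshare : nodes K ∩ nodes L ⊆ Node.e '' ((t.fv \ {x}) ∩ s.fv)) :
      Translates B (.lamApp x t s) ∅ ({.tens r a q, .par a x p} ∪ (K ∪ L)) r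
  /-- `t[x/u]`: the net of `t` with respect to `{x}`, its free variable `x` being the root of the
  net of `u`. -/
  | sub (x r : E) (t u : Term E) (K L : Set (Link E M))
      (ht : Translates B t {x} K r) (hu : Translates B u ∅ L x)
      (hshare : nodes K ∩ nodes L ⊆ Node.e '' ({x} ∪ ((t.fv \ {x}) ∩ u.fv))) :
      Translates B (.sub t x u) ∅ (K ∪ L) r
  /-- `X ∪ {y}` with `y` not free in `t`: a weakening on `y` is added. -/
  | weak (y r : E) (t : Term E) (X : Set E) (L : Set (Link E M))
      (ht : Translates B t X L r) (hy : y ∉ t.fv) (hfresh : Node.e y ∉ nodes L) :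
      Translates B t (X ∪ {y}) ({.weak y} ∪ L) r
  /-- `X ∪ {y}` with `y` free in `t`: nothing is added. -/
  | skip (y r : E) (t : Term E) (X : Set E) (L : Set (Link E M))
      (ht : Translates B t X L r) (hy : y ∈ t.fv) :
      Translates B t (X ∪ {y}) L r

end Nets

/-- The data of a net: its links, the assignment `box` of a set of links (the box) to every
`⅋`-link `par a x r`, and its root. -/
structure PreNet (E M : Type*) where
  links : Set (Link E M)
  box : M → E → E → Set (Link E M)
  root : E

namespace PreNet

variable {E M : Type*}

/-- `G` is a net. -/
def IsNet (G : PreNet E M) : Prop := _root_.IsNet G.box G.links G.root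

/-- `G` is correct. -/
def IsCorrect (G : PreNet E M) : Prop := _root_.IsCorrect G.box G.links G.root

/-- `G` is the translation of `t` with respect to `X`. -/
def IsTranslation (G : PreNet E M) (t : Term E) (X : Set E) : Prop :=
  Translates G.box t X G.links G.root

/-- The free variables of `G`. -/
def fv (G : PreNet E M) : Set E := Hyper.fv G.links

/-- The e-nodes of the free weakenings of `G`. -/
def freeWeakenings (G : PreNet E M) : Set E := Hyper.freeWeakenings G.links

end PreNet

/-!
A net is a correct net exactly when it is read off a term.

Correctness constrains a net through its correction graph, but the condition on sources can be
stated for the net itself: in a correct net the root is the only e-node without incoming link, at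
every level. In this form (`CorrectNet`, equivalent to "net and correct" by `correctNet_iff`)
correct nets are easily glued and cut, and boxes at level `0` are seen to be disjoint up to free
variables (`IsFragment.box_inter`, `IsFragment.box_disjoint`).

*Translations are correct nets* (`Translates.spec`), by induction on the translation. The links at
the root of a value or an application form a small fragment, which is put on top of the net of the
remaining subterm; for `t[x/u]` the net of `t` is put on top of the net of `u`. Glueing preserves
correctness (`CorrectNet.glue`), because a path of the correction graph that has entered the lower
net cannot leave it.

*Correct nets are translations* (`CorrectNet.exists_translates`), by induction on the number of
links. A free weakening is removed. Otherwise consider the cuts, that is, the e-nodes with an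
outgoing link at level `0` that are entered by derelictions or weakenings only; they are the nodes
`x` of the explicit substitutions `t[x/u]` at level `0`. Since the correction graph is finite and
acyclic, there is a cut `z` with no cut below it, unless there is no cut at all. Following the
links downwards from `z`, one only meets the arguments of applications, boxes and free variables of
the whole net, so that the part of the net below `z` is the translation of a term `u` without
substitutions at level `0`: the spine of `z` (`CorrectNet.exists_cut_or_spine`). The rest of the net
is a correct net with free variable `z` (`IsSpine.sdiff`), hence the translation of some `t`, and
the whole net is the translation of `t[z/u]`. If there is no cut, then the spine of the root is the
whole net (`IsSpine.eq_of_no_cut`).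
-/

/-! ### Nodes of hypergraphs -/

namespace Link

variable {E M : Type*}

/-- The link from the e-node `r` to the m-node `a` with the given e-target, if any: a `!`-link
without e-target, a `⊗`-link with one. These two cases are treated alike throughout. -/
def head (r : E) (a : M) : Option E → Link E M
  | none => .bang r a
  | some q => .tens r a q

variable {r x y : E} {a b : M} {o : Option E} {u : Node E M} {l : Link E M} {T : Set E}

@[simp] theorem mem_src_bang : u ∈ (bang x a).src ↔ u = .e x := Iff.rfl
@[simp] theorem mem_src_der : u ∈ (der a x).src ↔ u = .m a := Iff.rfl
@[simp] theorem mem_src_weak : u ∉ (weak x : Link E M).src := fun h => h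
@[simp] theorem mem_src_par : u ∈ (par a x y).src ↔ u = .m a ∨ u = .e x := Iff.rfl
@[simp] theorem mem_src_tens : u ∈ (tens x a y).src ↔ u = .e x := Iff.rfl
@[simp] theorem mem_src_square : u ∈ (square a T).src ↔ u = .m a := Iff.rfl
@[simp] theorem mem_tgt_bang : u ∈ (bang x a).tgt ↔ u = .m a := Iff.rfl
@[simp] theorem mem_tgt_der : u ∈ (der a x).tgt ↔ u = .e x := Iff.rfl
@[simp] theorem mem_tgt_weak : u ∈ (weak x : Link E M).tgt ↔ u = .e x := Iff.rfl
@[simp] theorem mem_tgt_par : u ∈ (par a x y).tgt ↔ u = .e y := Iff.rfl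
@[simp] theorem mem_tgt_tens : u ∈ (tens x a y).tgt ↔ u = .m a ∨ u = .e y := Iff.rfl
@[simp] theorem mem_tgt_square : u ∈ (square a T).tgt ↔ ∃ x ∈ T, .e x = u := Iff.rfl

@[simp] theorem mem_src_head : u ∈ (head r a o).src ↔ u = .e r := by cases o <;> simp [head]

@[simp] theorem mem_tgt_head : u ∈ (head r a o).tgt ↔ u = .m a ∨ ∃ q, o = some q ∧ u = .e q := by
  cases o <;> simp [head]

@[simp] theorem head_ne_par : head r a o ≠ par b x y := by cases o <;> simp [head]
@[simp] theorem head_ne_der : head r a o ≠ der b x := by cases o <;> simp [head]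
@[simp] theorem head_ne_weak : head r a o ≠ weak x := by cases o <;> simp [head]
@[simp] theorem head_ne_square : head r a o ≠ square b T := by cases o <;> simp [head]

end Link

namespace Hyper

variable {E M : Type*} {K L : Set (Link E M)} {u v : Node E M} {x y : E} {l : Link E M}

theorem nodes_mono (h : K ⊆ L) : nodes K ⊆ nodes L := fun _ ⟨l, hl, hu⟩ => ⟨l, h hl, hu⟩

theorem HasIn.mono (h : K ⊆ L) : HasIn K u → HasIn L u := fun ⟨l, hl, hu⟩ => ⟨l, h hl, hu⟩

theorem HasOut.mono (h : K ⊆ L) : HasOut K u → HasOut L u := fun ⟨l, hl, hu⟩ => ⟨l, h hl, hu⟩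

theorem HasIn.mem_nodes : HasIn L u → u ∈ nodes L := fun ⟨l, hl, hu⟩ => ⟨l, hl, .inr hu⟩

theorem HasOut.mem_nodes : HasOut L u → u ∈ nodes L := fun ⟨l, hl, hu⟩ => ⟨l, hl, .inl hu⟩

theorem mem_nodes_iff : u ∈ nodes L ↔ HasOut L u ∨ HasIn L u := by
  constructor
  · rintro ⟨l, hl, hu | hu⟩
    exacts [.inl ⟨l, hl, hu⟩, .inr ⟨l, hl, hu⟩]
  · rintro (h | h)
    exacts [h.mem_nodes, h.mem_nodes]

theorem hasIn_union : HasIn (K ∪ L) u ↔ HasIn K u ∨ HasIn L u := by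
  simp only [HasIn, Set.mem_union, or_and_right, exists_or]

theorem hasOut_union : HasOut (K ∪ L) u ↔ HasOut K u ∨ HasOut L u := by
  simp only [HasOut, Set.mem_union, or_and_right, exists_or]

theorem nodes_union : nodes (K ∪ L) = nodes K ∪ nodes L := by
  ext u
  simp only [nodes, Set.mem_union, or_and_right, exists_or, Set.mem_ofPred_eq]

theorem hasIn_pair {k : Link E M} : HasIn {k, l} u ↔ u ∈ k.tgt ∨ u ∈ l.tgt := by simp [HasIn]

theorem hasOut_pair {k : Link E M} : HasOut {k, l} u ↔ u ∈ k.src ∨ u ∈ l.src := by simp [HasOut]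

theorem hasIn_singleton : HasIn {l} u ↔ u ∈ l.tgt := by simp [HasIn]

theorem hasOut_singleton : HasOut {l} u ↔ u ∈ l.src := by simp [HasOut]

theorem mem_fv_iff : x ∈ fv L ↔ HasIn L (.e x) ∧ ¬ HasOut L (.e x) := by
  simp only [fv, Set.mem_ofPred_eq, mem_nodes_iff]
  tauto

/-- A free variable of a hypergraph is free in every subhypergraph it belongs to. -/
theorem mem_fv_of_subset (h : K ⊆ L) (hx : x ∈ fv L) (hK : .e x ∈ nodes K) : x ∈ fv K :=
  ⟨hK, fun ho => hx.2 (ho.mono h)⟩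

theorem Acyclic.mono (h : K ⊆ L) (hL : Acyclic L) : Acyclic K := fun u hu =>
  hL u (Relation.TransGen.mono (fun _ _ ⟨l, hl, huv⟩ => ⟨l, h hl, huv⟩) _ _ hu)

/-- If no link of `K` starts from a node of `L`, then a path of `K ∪ L` cannot leave `L`, so that
a cycle lies in `K` or in `L`. -/
theorem Acyclic.union (hK : Acyclic K) (hL : Acyclic L) (h : ∀ u ∈ nodes L, ¬ HasOut K u) :
    Acyclic (K ∪ L) := by
  have step : ∀ u v, Step (K ∪ L) u v → Step K u v ∨ (Step L u v) := by
    rintro u v ⟨l, hl | hl, huv⟩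
    exacts [.inl ⟨l, hl, huv⟩, .inr ⟨l, hl, huv⟩]
  have stay : ∀ u v, Relation.TransGen (Step (K ∪ L)) u v → u ∈ nodes L →
      Relation.TransGen (Step L) u v ∧ v ∈ nodes L := by
    intro u v huv hu
    induction huv with
    | single hs =>
      rcases step _ _ hs with ⟨l, hl, h1, _⟩ | hs
      · exact absurd ⟨l, hl, h1⟩ (h u hu)
      · refine ⟨.single hs, ?_⟩
        obtain ⟨l, hl, _, h2⟩ := hs
        exact ⟨l, hl, .inr h2⟩
    | tail _ hs ih =>
      rcases step _ _ hs with ⟨l, hl, h1, _⟩ | hs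
      · exact absurd ⟨l, hl, h1⟩ (h _ ih.2)
      · refine ⟨ih.1.tail hs, ?_⟩
        obtain ⟨l, hl, _, h2⟩ := hs
        exact ⟨l, hl, .inr h2⟩
  have enter : ∀ u v, Relation.TransGen (Step (K ∪ L)) u v →
      Relation.TransGen (Step K) u v ∨ v ∈ nodes L := by
    intro u v huv
    induction huv with
    | single hs =>
      rcases step _ _ hs with hs | ⟨l, hl, _, h2⟩
      exacts [.inl (.single hs), .inr ⟨l, hl, .inr h2⟩]
    | tail _ hs ih =>
      rcases step _ _ hs with hs | ⟨l, hl, _, h2⟩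
      · rcases ih with ih | ih
        · exact .inl (ih.tail hs)
        · obtain ⟨l, hl, h1, _⟩ := hs
          exact absurd ⟨l, hl, h1⟩ (h _ ih)
      · exact .inr ⟨l, hl, .inr h2⟩
  intro u hu
  rcases enter u u hu with hu' | hu'
  exacts [hK u hu', hL u (stay u u hu hu').1]

/-- The hypergraph of a link out of the e-node `r` and a link from an m-node `a` to e-nodes is
acyclic if no link enters `r`. -/
theorem acyclic_pair {k : Link E M} {r : E} {a : M} (hl : ∀ u ∈ l.src, u = .e r)
    (hlr : .e r ∉ l.tgt) (hk : ∀ u ∈ k.src, u = .m a) (hkr : .e r ∉ k.tgt)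
    (hka : ∀ b, .m b ∉ k.tgt) : Acyclic {l, k} := by
  have key : ∀ u v, Relation.TransGen (Step {l, k}) u v →
      v ≠ .e r ∧ (u = .m a → ∃ y, v = .e y) ∧ (u = .e r ∨ u = .m a) := by
    have tgt : ∀ u v, Step {l, k} u v → v ≠ .e r := by
      rintro u v ⟨j, rfl | rfl, _, hv⟩ rfl
      exacts [hlr hv, hkr hv]
    intro u v huv
    induction huv with
    | single hs =>
      refine ⟨tgt _ _ hs, ?_⟩
      obtain ⟨j, rfl | rfl, h1, h2⟩ := hs
      · simp [hl _ h1]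
      · rename_i v
        cases v with
        | e y => simp [hk _ h1]
        | m b => exact absurd h2 (hka b)
    | tail _ hs ih =>
      refine ⟨tgt _ _ hs, fun hu => ?_, ih.2.2⟩
      obtain ⟨y, rfl⟩ := ih.2.1 hu
      obtain ⟨j, rfl | rfl, h1, h2⟩ := hs
      · exact absurd (hl _ h1) ih.1
      · exact absurd (hk _ h1) (by simp)
  intro u hu
  obtain ⟨h1, h2, rfl | rfl⟩ := key u u hu
  · exact h1 rfl
  · obtain ⟨y, hy⟩ := h2 rfl
    cases hy

end Hyper

section Fragments

variable {E M : Type*} {B : M → E → E → Set (Link E M)} {L : Set (Link E M)} {r x y s q : E}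
  {a b : M} {u : Node E M} {k l : Link E M}

open Hyper

/-! ### Fragments of correct nets -/

/-- A fragment of a correct net: the requirements on a net except those on its root and on its
conclusions, together with the correctness of every box. -/
structure IsFragment (B : M → E → E → Set (Link E M)) (L : Set (Link E M)) : Prop where
  finite : L.Finite
  labels : ∀ a T, Link.square a T ∉ L
  multiplicative : ∀ a, Node.m a ∈ nodes L →
    (∃! l, l ∈ L ∧ Node.m a ∈ l.tgt) ∧ (∃! l, l ∈ L ∧ Node.m a ∈ l.src)
  exponential_out : ∀ x, ∀ l ∈ L, ∀ k ∈ L, Node.e x ∈ l.src → Node.e x ∈ k.src → l = k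
  exponential_in : ∀ x, ∀ l ∈ L, ∀ k ∈ L, Node.e x ∈ l.tgt → Node.e x ∈ k.tgt → l ≠ k →
    (∃ a, l = .der a x) ∧ (∃ b, k = .der b x)
  box_net : ∀ a x s, Link.par a x s ∈ L → IsNet B (B a x s) s
  box_correct : ∀ a x s, Link.par a x s ∈ L → IsCorrect B (B a x s) s
  border : ∀ a x s, Link.par a x s ∈ L →
    x ∈ fv (B a x s) ∧ ∀ y ∈ fv (B a x s), y ≠ x → Link.weak y ∉ B a x s
  nesting : ∀ a x s b y q, Link.par a x s ∈ L → Link.par b y q ∈ L →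
    ¬ B a x s ⊆ B b y q → ¬ B b y q ⊆ B a x s →
    nodes (B a x s) ∩ nodes (B b y q) ⊆ Node.e '' (fv (B a x s) ∩ fv (B b y q))
  internal_closure : ∀ a x s, Link.par a x s ∈ L →
    ∀ z, (Internal (B a x s) (.e z) ∨ z = x) → ∀ l ∈ L, Node.e z ∈ l.tgt → l ∈ B a x s
  subnet : ∀ a x s, Link.par a x s ∈ L → B a x s ⊆ L

/-- A correct net, with the condition on its sources stated for the net itself instead of its
correction graph; see `correctNet_iff`. -/
structure CorrectNet (B : M → E → E → Set (Link E M)) (L : Set (Link E M)) (r : E) : Prop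
    extends IsFragment B L where
  source : ∀ x, (Node.e x ∈ nodes L ∧ ¬ HasIn L (.e x)) ↔ x = r
  conclusions : ∀ x ∈ fv L, ∀ l ∈ L, Node.e x ∈ l.tgt → (∃ a, l = .der a x) ∨ l = .weak x
  acyclic : Acyclic (correctionGraph B L)

/-- A `⅋`-link does not belong to its own box, since the nesting of boxes is well-founded. -/
theorem IsNet.par_notMem_box (hL : IsNet B L r) (h : .par a x s ∈ L) :
    Link.par a x s ∉ B a x s := by
  have key : ∀ L r, IsNet B L r → ∀ a x s, Link.par a x s ∈ L → B a x s ≠ L := by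
    intro L r hL
    induction hL with
    | intro L r _ _ _ _ _ _ _ box_net _ _ _ _ ih =>
      rintro a x s h rfl
      exact ih a x s h a x s h rfl
  cases hL with
  | intro _ _ _ _ _ _ _ _ _ box_net =>
    exact fun h' => key _ _ (box_net a x s h) a x s h' rfl

namespace IsFragment

theorem out_unique (h : IsFragment B L) (hl : l ∈ L) (hk : k ∈ L) (hul : u ∈ l.src)
    (huk : u ∈ k.src) : l = k := by
  cases u with
  | e x => exact h.exponential_out x l hl k hk hul huk
  | m a => exact (h.multiplicative a ⟨l, hl, .inl hul⟩).2.unique ⟨hl, hul⟩ ⟨hk, huk⟩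

theorem in_unique_m (h : IsFragment B L) (hl : l ∈ L) (hk : k ∈ L) (hul : .m a ∈ l.tgt)
    (huk : .m a ∈ k.tgt) : l = k :=
  (h.multiplicative a ⟨l, hl, .inr hul⟩).1.unique ⟨hl, hul⟩ ⟨hk, huk⟩

theorem in_unique_e (h : IsFragment B L) (hl : l ∈ L) (hk : k ∈ L) (hul : .e x ∈ l.tgt)
    (huk : .e x ∈ k.tgt) (hne : ∀ a, l ≠ .der a x) : l = k := by
  by_contra hlk
  obtain ⟨a, ha⟩ := (h.exponential_in x l hl k hk hul huk hlk).1
  exact hne a ha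

theorem hasIn_m (h : IsFragment B L) (ha : .m a ∈ nodes L) : HasIn L (.m a) :=
  let ⟨l, hl, _⟩ := (h.multiplicative a ha).1
  ⟨l, hl.1, hl.2⟩

theorem hasOut_m (h : IsFragment B L) (ha : .m a ∈ nodes L) : HasOut L (.m a) :=
  let ⟨l, hl, _⟩ := (h.multiplicative a ha).2
  ⟨l, hl.1, hl.2⟩

theorem par_inj (h : IsFragment B L) (hl : .par a x s ∈ L) (hk : .par b y q ∈ L)
    (hul : u ∈ (Link.par a x s).src) (huk : u ∈ (Link.par b y q).src) :
    a = b ∧ x = y ∧ s = q := by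
  simpa using h.out_unique hl hk hul huk

theorem isNet (h : IsFragment B L) (root : Node.e r ∈ nodes L ∧ ¬ HasIn L (.e r))
    (conclusions : ∀ x ∈ fv L, ∀ l ∈ L, Node.e x ∈ l.tgt → (∃ a, l = .der a x) ∨ l = .weak x) :
    IsNet B L r :=
  .intro L r h.finite h.labels root conclusions h.multiplicative h.exponential_out
    h.exponential_in h.box_net h.border h.nesting h.internal_closure h.subnet

end IsFragment

theorem levelZero_subset : levelZero B L ⊆ L := fun _ h => h.1

theorem mem_correctionGraph_of_ne_par (hl : l ∈ levelZero B L) (h : ∀ a x r, l ≠ .par a x r) :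
    l ∈ correctionGraph B L := .inl ⟨hl, h⟩

theorem square_mem_correctionGraph (hl : .par a x s ∈ levelZero B L) :
    .square a (fv (B a x s) \ {x}) ∈ correctionGraph B L := .inr ⟨a, x, s, hl, rfl⟩

namespace IsFragment

theorem hasOut_of_correctionGraph (h : HasOut (correctionGraph B L) u) : HasOut L u := by
  obtain ⟨l, hl | ⟨a, x, s, hl, rfl⟩, hu⟩ := h
  · exact ⟨l, hl.1.1, hu⟩
  · exact ⟨_, hl.1, .inl hu⟩

theorem hasIn_of_correctionGraph (hL : IsFragment B L) (h : HasIn (correctionGraph B L) u) :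
    HasIn L u := by
  obtain ⟨l, hl | ⟨a, x, s, hl, rfl⟩, hu⟩ := h
  · exact ⟨l, hl.1.1, hu⟩
  · obtain ⟨y, hy, rfl⟩ := hu
    exact (mem_fv_iff.1 hy.1).1.mono (hL.subnet _ _ _ hl.1)

theorem nodes_correctionGraph_subset (hL : IsFragment B L) :
    nodes (correctionGraph B L) ⊆ nodes L := fun _ hu =>
  (mem_nodes_iff.1 hu).elim (fun h => (hasOut_of_correctionGraph h).mem_nodes)
    fun h => (hL.hasIn_of_correctionGraph h).mem_nodes

end IsFragment

theorem mem_levelZero_or (hl : l ∈ L) :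
    l ∈ levelZero B L ∨ ∃ a x s, Link.par a x s ∈ L ∧ l ∈ B a x s := by
  by_contra! h
  exact h.1 ⟨hl, fun a x r hp => h.2 a x r hp⟩

/-- A correct net has no e-node without incoming link besides its root. -/
theorem IsCorrect.eq_root (hC : IsCorrect B L r) (hN : IsNet B L r) :
    ∀ x, Node.e x ∈ nodes L → ¬ HasIn L (.e x) → x = r := by
  induction hC with
  | intro L r source acyclic box_correct ih =>
    cases hN with
    | intro _ _ finite labels root conclusions multiplicative exponential_out exponential_in
        box_net border nesting internal_closure subnet =>
    have hL : IsFragment B L := ⟨finite, labels, multiplicative, exponential_out, exponential_in,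
        box_net, box_correct, border, nesting, internal_closure, subnet⟩
    rintro x ⟨l, hl, hu⟩ hx
    rcases mem_levelZero_or (B := B) hl with hl0 | ⟨a, y, s, hp, hlb⟩
    · by_cases hpar : ∃ a x s, l = .par a x s
      · obtain ⟨a, z, s, rfl⟩ := hpar
        exfalso
        rcases hu with hu | hu
        · obtain rfl : x = z := by simpa using hu
          exact hx ((mem_fv_iff.1 (border _ _ _ hl).1).1.mono (subnet _ _ _ hl))
        · exact hx ⟨_, hl, hu⟩
      · push Not at hpar
        refine (source x).1 ⟨⟨l, mem_correctionGraph_of_ne_par hl0 hpar, hu⟩, ?_⟩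
        exact fun h => hx (hL.hasIn_of_correctionGraph h)
    · exfalso
      have := ih a y s hp (box_net a y s hp) x ⟨l, hlb, hu⟩
        fun h => hx (h.mono (subnet _ _ _ hp))
      subst this
      exact hx ⟨_, hp, rfl⟩

namespace IsFragment

theorem of_net (hN : IsNet B L r) (hC : IsCorrect B L r) : IsFragment B L := by
  cases hN; cases hC; constructor <;> assumption

theorem box_fragment (h : IsFragment B L) (hp : .par a x s ∈ L) : IsFragment B (B a x s) :=
  of_net (h.box_net a x s hp) (h.box_correct a x s hp)

theorem eq_root_box (h : IsFragment B L) (hp : .par a x s ∈ L) (hy : .e y ∈ nodes (B a x s))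
    (hi : ¬ HasIn (B a x s) (.e y)) : y = s :=
  (h.box_correct a x s hp).eq_root (h.box_net a x s hp) y hy hi

theorem par_notMem_box (h : IsFragment B L) (hp : .par a x s ∈ L) :
    Link.par a x s ∉ B a x s := fun h' =>
  (h.box_net a x s hp).par_notMem_box h' h'

theorem var_hasIn (h : IsFragment B L) (hp : .par a x s ∈ L) : HasIn L (.e x) :=
  (mem_fv_iff.1 (h.border _ _ _ hp).1).1.mono (h.subnet _ _ _ hp)

/-- A `⅋`-link of `L` whose box is contained in another box belongs to that box. -/
theorem par_mem_box (h : IsFragment B L) (hp : .par a x s ∈ L) (hq : .par b y q ∈ L)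
    (hs : B a x s ⊆ B b y q) : .par a x s ∈ B b y q ∨ a = b ∧ x = y ∧ s = q := by
  have hroot : .e s ∈ nodes (B a x s) ∧ ¬ HasIn (B a x s) (.e s) := by
    cases h.box_net a x s hp; assumption
  have hout : HasOut (B a x s) (.e s) := (mem_nodes_iff.1 hroot.1).resolve_right hroot.2
  by_cases hi : HasIn (B b y q) (.e s)
  · exact .inl (h.internal_closure b y q hq s (.inl ⟨hi, hout.mono hs⟩) _ hp rfl)
  · obtain rfl := h.eq_root_box hq (nodes_mono hs hroot.1) hi
    have := h.in_unique_e (x := s) hp hq rfl rfl (by simp)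
    right; simpa using this

/-- Every link of a box is contained in a box of a `⅋`-link at level `0`: an inclusion-maximal
box. -/
theorem exists_outer (h : IsFragment B L) (hp : .par a x s ∈ L) :
    ∃ b y q, .par b y q ∈ levelZero B L ∧ B a x s ⊆ B b y q := by
  induction hn : (L \ B a x s).ncard using Nat.strong_induction_on generalizing a x s with
  | _ n ih =>
    rcases mem_levelZero_or (B := B) hp with h0 | ⟨b, y, q, hq, hpq⟩
    · exact ⟨a, x, s, h0, subset_rfl⟩
    · have hsub : B a x s ⊆ B b y q := (h.box_fragment hq).subnet _ _ _ hpq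
      have hlt : (L \ B b y q).ncard < n := by
        rw [← hn]
        refine Set.ncard_lt_ncard ⟨Set.sdiff_subset_sdiff_right hsub, fun hc => ?_⟩
          (h.finite.subset Set.sdiff_subset)
        exact (hc ⟨hp, h.par_notMem_box hp⟩).2 hpq
      obtain ⟨c, z, t, hc, hs⟩ := ih _ hlt hq rfl
      exact ⟨c, z, t, hc, hsub.trans hs⟩

theorem levelZero_or_outer (h : IsFragment B L) (hl : l ∈ L) :
    l ∈ levelZero B L ∨ ∃ a x s, .par a x s ∈ levelZero B L ∧ l ∈ B a x s := by
  rcases mem_levelZero_or (B := B) hl with h0 | ⟨a, x, s, hp, hlp⟩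
  · exact .inl h0
  · obtain ⟨b, y, q, hq, hs⟩ := h.exists_outer hp
    exact .inr ⟨b, y, q, hq, hs hlp⟩

/-- Two different boxes at level `0` share nothing but free variables. -/
theorem box_inter (h : IsFragment B L) (hp : .par a x s ∈ levelZero B L)
    (hq : .par b y q ∈ levelZero B L) (hne : ¬ (a = b ∧ x = y ∧ s = q))
    (hua : u ∈ nodes (B a x s)) (hub : u ∈ nodes (B b y q)) :
    ∃ z, u = .e z ∧ z ∈ fv (B a x s) ∧ z ∈ fv (B b y q) := by
  have h1 : ¬ B a x s ⊆ B b y q := fun hs =>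
    (h.par_mem_box hp.1 hq.1 hs).elim (hp.2 _ _ _ hq.1) hne
  have h2 : ¬ B b y q ⊆ B a x s := fun hs =>
    (h.par_mem_box hq.1 hp.1 hs).elim (hq.2 _ _ _ hp.1) (by tauto)
  obtain ⟨z, hz, rfl⟩ := h.nesting _ _ _ _ _ _ hp.1 hq.1 h1 h2 ⟨hua, hub⟩
  exact ⟨z, rfl, hz⟩

/-- A link of a fragment is attached to an m-node unless it is a weakening. -/
theorem eq_weak_or_m (h : IsFragment B L) (hl : l ∈ L) :
    (∃ x, l = .weak x) ∨ ∃ a, .m a ∈ l.src ∨ .m a ∈ l.tgt := by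
  cases l with
  | weak x => exact .inl ⟨x, rfl⟩
  | square a T => exact absurd hl (h.labels a T)
  | bang x a => exact .inr ⟨a, by simp⟩
  | der a x => exact .inr ⟨a, by simp⟩
  | par a x s => exact .inr ⟨a, by simp⟩
  | tens x a y => exact .inr ⟨a, by simp⟩

/-- Different boxes at level `0` share no link: a shared link would be a weakening on a free
variable of both, hence on the variable of both `⅋`-links. -/
theorem box_disjoint (h : IsFragment B L) (hp : .par a x s ∈ levelZero B L)
    (hq : .par b y q ∈ levelZero B L) (hla : l ∈ B a x s) (hlb : l ∈ B b y q) :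
    a = b ∧ x = y ∧ s = q := by
  by_contra hne
  rcases h.eq_weak_or_m (h.subnet _ _ _ hp.1 hla) with ⟨z, rfl⟩ | ⟨c, hc⟩
  · obtain ⟨_, he, ha, hb⟩ :=
      h.box_inter (u := .e z) hp hq hne ⟨_, hla, .inr rfl⟩ ⟨_, hlb, .inr rfl⟩
    cases he
    have hx : z = x := by_contra fun hzx => (h.border _ _ _ hp.1).2 z ha hzx hla
    have hy : z = y := by_contra fun hzy => (h.border _ _ _ hq.1).2 z hb hzy hlb
    exact hne (h.par_inj (u := .e z) hp.1 hq.1 (.inr (by simp [hx])) (.inr (by simp [hy])))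
  · obtain ⟨_, he, -⟩ := h.box_inter hp hq hne ⟨_, hla, hc⟩ ⟨_, hlb, hc⟩
    cases he

/-- An e-node of the correction graph has an incoming link there if it has one in the net. -/
theorem hasIn_correctionGraph (h : IsFragment B L) (hx : .e x ∈ nodes (correctionGraph B L))
    (hi : HasIn L (.e x)) : HasIn (correctionGraph B L) (.e x) := by
  obtain ⟨k, hk, hu | hu⟩ := hx
  · rcases hk with ⟨hk, hkp⟩ | ⟨a, y, s, hp, rfl⟩
    · obtain ⟨l, hl, hxl⟩ := hi
      rcases h.levelZero_or_outer hl with hl0 | ⟨a, y, s, hp, hlb⟩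
      · by_cases hpar : ∃ a x s, l = .par a x s
        · -- The root of a box has its outgoing link in the box.
          obtain ⟨a, y, s, rfl⟩ := hpar
          obtain rfl : x = s := by simpa using hxl
          have hroot : .e x ∈ nodes (B a y x) ∧ ¬ HasIn (B a y x) (.e x) := by
            cases h.box_net a y x hl; assumption
          obtain ⟨j, hj, hxj⟩ := (mem_nodes_iff.1 hroot.1).resolve_right hroot.2
          have := h.out_unique hk.1 (h.subnet _ _ _ hl hj) hu hxj
          exact absurd (this ▸ hj) (hk.2 _ _ _ hl)
        · push Not at hpar
          exact ⟨l, mem_correctionGraph_of_ne_par hl0 hpar, hxl⟩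
      · by_cases hxy : x = y
        · subst hxy
          have := h.out_unique hk.1 hp.1 hu (.inr rfl)
          exact absurd this (hkp _ _ _)
        · by_cases ho : HasOut (B a y s) (.e x)
          · obtain ⟨j, hj, hxj⟩ := ho
            have := h.out_unique hk.1 (h.subnet _ _ _ hp.1 hj) hu hxj
            exact absurd (this ▸ hj) (hk.2 _ _ _ hp.1)
          · exact ⟨_, square_mem_correctionGraph hp, x, ⟨mem_fv_iff.2 ⟨⟨l, hlb, hxl⟩, ho⟩, hxy⟩, rfl⟩
    · simp at hu
  · exact ⟨k, hk, hu⟩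

end IsFragment

namespace CorrectNet

theorem isNet (h : CorrectNet B L r) : IsNet B L r :=
  h.toIsFragment.isNet ((h.source r).2 rfl) h.conclusions

theorem eq_root (h : CorrectNet B L r) (hx : .e x ∈ nodes L) (hi : ¬ HasIn L (.e x)) : x = r :=
  (h.source x).1 ⟨hx, hi⟩

theorem root_mem (h : CorrectNet B L r) : .e r ∈ nodes L := ((h.source r).2 rfl).1

theorem not_hasIn_root (h : CorrectNet B L r) : ¬ HasIn L (.e r) := ((h.source r).2 rfl).2

theorem hasOut_root (h : CorrectNet B L r) : HasOut L (.e r) :=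
  (mem_nodes_iff.1 h.root_mem).resolve_right h.not_hasIn_root

theorem root_notMem_fv (h : CorrectNet B L r) : r ∉ fv L := fun hr => hr.2 h.hasOut_root

/-- The root of a correct net belongs to no box. -/
theorem root_notMem_box (h : CorrectNet B L r) (hp : .par a x s ∈ L) :
    .e r ∉ nodes (B a x s) := fun hr => by
  obtain rfl := h.eq_root_box hp hr fun hi => h.not_hasIn_root (hi.mono (h.subnet _ _ _ hp))
  exact h.not_hasIn_root ⟨_, hp, rfl⟩

theorem isCorrect (h : CorrectNet B L r) : IsCorrect B L r := by
  refine .intro L r (fun x => ⟨fun hx => ?_, ?_⟩) h.acyclic h.box_correct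
  · exact h.eq_root (h.nodes_correctionGraph_subset hx.1)
      fun hi => hx.2 (h.hasIn_correctionGraph hx.1 hi)
  · rintro rfl
    refine ⟨?_, fun hi => h.not_hasIn_root (h.hasIn_of_correctionGraph hi)⟩
    obtain ⟨l, hl, hx⟩ := h.hasOut_root
    refine ⟨l, mem_correctionGraph_of_ne_par ⟨hl, fun a y s hp hlb => ?_⟩ ?_, .inl hx⟩
    · exact h.root_notMem_box hp ⟨l, hlb, .inl hx⟩
    · rintro a y s rfl
      obtain rfl : x = y := by simpa using hx
      exact h.not_hasIn_root (h.var_hasIn hl)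

end CorrectNet

theorem correctNet_iff : CorrectNet B L r ↔ IsNet B L r ∧ IsCorrect B L r := by
  refine ⟨fun h => ⟨h.isNet, h.isCorrect⟩, fun ⟨hN, hC⟩ => ?_⟩
  have hF := IsFragment.of_net hN hC
  have hE := hC.eq_root hN
  cases hN; cases hC
  refine { hF with source := fun x => ⟨fun hx => hE x hx.1 hx.2, ?_⟩, conclusions := ?_, acyclic := ?_ }
  · rintro rfl; assumption
  · assumption
  · assumption

end Fragments

section Glueing

variable {E M : Type*} {B : M → E → E → Set (Link E M)} {K L : Set (Link E M)} {r x y z s q p : E}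
  {a b : M} {u : Node E M} {k l : Link E M} {o : Option E}

open Hyper

/-! ### Glueing fragments -/

/-- `K` can be put on top of `L`: the shared nodes are free variables of `K`, each of which is
either a source of `L` or a free variable of `L` as well, and in the latter case it is the target
of derelictions only. -/
def Hyper.Glueable (K L : Set (Link E M)) : Prop :=
  ∀ u ∈ nodes K, u ∈ nodes L → ∃ y, u = .e y ∧ y ∈ fv K ∧
    (¬ HasIn L (.e y) ∨ y ∈ fv L ∧ ∀ l ∈ K ∪ L, .e y ∈ l.tgt → ∃ a, l = .der a y)

namespace IsFragment

theorem disjoint_of_glueable (hK : IsFragment B K) (hg : Glueable K L) (hlK : l ∈ K) :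
    l ∉ L := by
  intro hlL
  rcases hK.eq_weak_or_m hlK with ⟨y, rfl⟩ | ⟨a, ha⟩
  · obtain ⟨_, he, -, h⟩ := hg (.e y) ⟨_, hlK, .inr rfl⟩ ⟨_, hlL, .inr rfl⟩
    cases he
    rcases h with h | ⟨-, h⟩
    · exact h ⟨_, hlL, rfl⟩
    · obtain ⟨a, ha⟩ := h _ (.inl hlK) rfl
      cases ha
  · obtain ⟨_, he, -⟩ := hg _ ⟨l, hlK, ha⟩ ⟨l, hlL, ha⟩
    cases he

/-- Glueing `K` on top of `L` touches a box of `L` in free variables only: the boxes of `L` do not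
contain sources of `L`. -/
theorem mem_fv_box_of_glueable (hL : IsFragment B L) (hg : Glueable K L)
    (hp : .par a x s ∈ L) (huK : u ∈ nodes K) (hu : u ∈ nodes (B a x s)) :
    ∃ y, u = .e y ∧ y ∈ fv K ∧ y ∈ fv L ∧ y ∈ fv (B a x s) := by
  obtain ⟨y, rfl, hyK, hy⟩ := hg u huK (nodes_mono (hL.subnet _ _ _ hp) hu)
  rcases hy with hy | ⟨hy, -⟩
  · obtain rfl := hL.eq_root_box hp hu fun hi => hy (hi.mono (hL.subnet _ _ _ hp))
    exact absurd ⟨_, hp, rfl⟩ hy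
  · exact ⟨y, rfl, hyK, hy, mem_fv_of_subset (hL.subnet _ _ _ hp) hy hu⟩

theorem union (hK : IsFragment B K) (hL : IsFragment B L) (hg : Glueable K L) :
    IsFragment B (K ∪ L) := by
  have nom : ∀ {a}, .m a ∈ nodes K → .m a ∉ nodes L := fun h h' => by
    obtain ⟨_, he, -⟩ := hg _ h h'
    cases he
  have noout : ∀ {u}, HasOut K u → u ∉ nodes L := fun h h' => by
    obtain ⟨_, rfl, hu, -⟩ := hg _ h.mem_nodes h'
    exact hu.2 h
  have mixed_in : ∀ {x k l}, k ∈ K → l ∈ L → .e x ∈ k.tgt → .e x ∈ l.tgt →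
      (∃ a, k = .der a x) ∧ ∃ b, l = .der b x := fun {x k l} hk hl hxk hxl => by
    obtain ⟨_, he, -, h⟩ := hg (.e x) ⟨k, hk, .inr hxk⟩ ⟨l, hl, .inr hxl⟩
    cases he
    rcases h with h | ⟨-, h⟩
    · exact absurd ⟨l, hl, hxl⟩ h
    · exact ⟨h _ (.inl hk) hxk, h _ (.inr hl) hxl⟩
  have mixed_nesting : ∀ {a x s b y q}, Link.par a x s ∈ K → Link.par b y q ∈ L →
      nodes (B a x s) ∩ nodes (B b y q) ⊆ Node.e '' (fv (B a x s) ∩ fv (B b y q)) := by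
    rintro a x s b y q hp hq u ⟨hua, hub⟩
    obtain ⟨y, rfl, hyK, -, hy⟩ :=
      hL.mem_fv_box_of_glueable hg hq (nodes_mono (hK.subnet _ _ _ hp) hua) hub
    exact ⟨y, ⟨mem_fv_of_subset (hK.subnet _ _ _ hp) hyK hua, hy⟩, rfl⟩
  refine ⟨hK.finite.union hL.finite, ?_, ?_, ?_, ?_, ?_, ?_, ?_, ?_, ?_, ?_⟩
  · rintro a T (h | h)
    exacts [hK.labels a T h, hL.labels a T h]
  · intro a ha
    rw [nodes_union] at ha
    rcases ha with ha | ha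
    · obtain ⟨⟨i, hi, hi'⟩, ⟨j, hj, hj'⟩⟩ := hK.multiplicative a ha
      refine ⟨⟨i, ⟨.inl hi.1, hi.2⟩, ?_⟩, ⟨j, ⟨.inl hj.1, hj.2⟩, ?_⟩⟩
      · rintro k ⟨hk | hk, hk'⟩
        exacts [hi' _ ⟨hk, hk'⟩, absurd ⟨k, hk, .inr hk'⟩ (nom ha)]
      · rintro k ⟨hk | hk, hk'⟩
        exacts [hj' _ ⟨hk, hk'⟩, absurd ⟨k, hk, .inl hk'⟩ (nom ha)]
    · obtain ⟨⟨i, hi, hi'⟩, ⟨j, hj, hj'⟩⟩ := hL.multiplicative a ha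
      refine ⟨⟨i, ⟨.inr hi.1, hi.2⟩, ?_⟩, ⟨j, ⟨.inr hj.1, hj.2⟩, ?_⟩⟩
      · rintro k ⟨hk | hk, hk'⟩
        exacts [absurd ha (nom ⟨k, hk, .inr hk'⟩), hi' _ ⟨hk, hk'⟩]
      · rintro k ⟨hk | hk, hk'⟩
        exacts [absurd ha (nom ⟨k, hk, .inl hk'⟩), hj' _ ⟨hk, hk'⟩]
  · rintro x l (hl | hl) k (hk | hk) hxl hxk
    · exact hK.exponential_out x l hl k hk hxl hxk
    · exact absurd ⟨k, hk, .inl hxk⟩ (noout ⟨l, hl, hxl⟩)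
    · exact absurd ⟨l, hl, .inl hxl⟩ (noout ⟨k, hk, hxk⟩)
    · exact hL.exponential_out x l hl k hk hxl hxk
  · rintro x l (hl | hl) k (hk | hk) hxl hxk hne
    · exact hK.exponential_in x l hl k hk hxl hxk hne
    · exact mixed_in hl hk hxl hxk
    · exact (mixed_in hk hl hxk hxl).symm
    · exact hL.exponential_in x l hl k hk hxl hxk hne
  · rintro a x s (h | h)
    exacts [hK.box_net a x s h, hL.box_net a x s h]
  · rintro a x s (h | h)
    exacts [hK.box_correct a x s h, hL.box_correct a x s h]
  · rintro a x s (h | h)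
    exacts [hK.border a x s h, hL.border a x s h]
  · rintro a x s b y q (hp | hp) (hq | hq) h1 h2
    · exact hK.nesting a x s b y q hp hq h1 h2
    · exact mixed_nesting hp hq
    · rw [Set.inter_comm, Set.inter_comm (fv _)]
      exact mixed_nesting hq hp
    · exact hL.nesting a x s b y q hp hq h1 h2
  · rintro a x s (hp | hp) z hz l (hl | hl) hzl
    · exact hK.internal_closure a x s hp z hz l hl hzl
    · have : HasOut K (.e z) := by
        rcases hz with hz | rfl
        exacts [hz.2.mono (hK.subnet _ _ _ hp), ⟨_, hp, .inr rfl⟩]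
      exact absurd ⟨l, hl, .inr hzl⟩ (noout this)
    · have hzb : .e z ∈ nodes (B a x s) := by
        rcases hz with hz | rfl
        exacts [hz.1.mem_nodes, (hL.border _ _ _ hp).1.1]
      obtain ⟨y, he, -, hyL, -⟩ := hL.mem_fv_box_of_glueable hg hp ⟨l, hl, .inr hzl⟩ hzb
      cases he
      have : HasOut L (.e z) := by
        rcases hz with hz | rfl
        exacts [hz.2.mono (hL.subnet _ _ _ hp), ⟨_, hp, .inr rfl⟩]
      exact absurd this hyL.2
    · exact hL.internal_closure a x s hp z hz l hl hzl
  · rintro a x s (h | h)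
    exacts [(hK.subnet a x s h).trans Set.subset_union_left,
      (hL.subnet a x s h).trans Set.subset_union_right]

theorem levelZero_union (hK : IsFragment B K) (hL : IsFragment B L) (hg : Glueable K L) :
    levelZero B (K ∪ L) = levelZero B K ∪ levelZero B L := by
  ext l
  constructor
  · rintro ⟨hl | hl, h⟩
    exacts [.inl ⟨hl, fun a x s hp => h a x s (.inl hp)⟩,
      .inr ⟨hl, fun a x s hp => h a x s (.inr hp)⟩]
  · rintro (⟨hl, h⟩ | ⟨hl, h⟩)
    · refine ⟨.inl hl, ?_⟩
      rintro a x s (hp | hp)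
      · exact h a x s hp
      · exact fun hlb => hK.disjoint_of_glueable hg hl (hL.subnet _ _ _ hp hlb)
    · refine ⟨.inr hl, ?_⟩
      rintro a x s (hp | hp)
      · exact fun hlb => hK.disjoint_of_glueable hg (hK.subnet _ _ _ hp hlb) hl
      · exact h a x s hp

theorem acyclic_union (hK : IsFragment B K) (hL : IsFragment B L) (hg : Glueable K L)
    (hcK : Acyclic (correctionGraph B K)) (hcL : Acyclic (correctionGraph B L)) :
    Acyclic (correctionGraph B (K ∪ L)) := by
  have : correctionGraph B (K ∪ L) = correctionGraph B K ∪ correctionGraph B L := by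
    ext l
    simp only [correctionGraph, hK.levelZero_union hL hg, Set.mem_union, Set.mem_ofPred_eq,
      or_and_right, exists_or]
    exact or_or_or_comm
  rw [this]
  refine hcK.union hcL fun u huL huK => ?_
  obtain ⟨y, rfl, hy, -⟩ := hg u (hasOut_of_correctionGraph huK).mem_nodes
    (hL.nodes_correctionGraph_subset huL)
  exact hy.2 (hasOut_of_correctionGraph huK)

end IsFragment

/-- Glueing a correct net `L` to a node `z` of a fragment `K` with a single source `r`. -/
theorem CorrectNet.glue (hK : IsFragment B K) (hcK : Acyclic (correctionGraph B K))
    (hL : CorrectNet B L z) (hg : Glueable K L)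
    (hr : ∀ x, (.e x ∈ nodes K ∧ ¬ HasIn K (.e x)) ↔ x = r) (hrL : .e r ∉ nodes L)
    (hz : HasIn K (.e z))
    (hcon : ∀ y ∈ fv K, y ≠ z → ∀ l ∈ K, .e y ∈ l.tgt → (∃ a, l = .der a y) ∨ l = .weak y) :
    CorrectNet B (K ∪ L) r where
  toIsFragment := hK.union hL.toIsFragment hg
  source x := by
    rw [nodes_union, hasIn_union]
    constructor
    · rintro ⟨hx | hx, hi⟩
      · exact (hr x).1 ⟨hx, fun h => hi (.inl h)⟩
      · obtain rfl := hL.eq_root hx fun h => hi (.inr h)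
        exact absurd (.inl hz) hi
    · rintro rfl
      have := (hr x).2 rfl
      exact ⟨.inl this.1, fun h => h.elim this.2 fun h => hrL h.mem_nodes⟩
  conclusions y hy l hl hyl := by
    rcases hl with hl | hl
    · refine hcon y (mem_fv_of_subset Set.subset_union_left hy ⟨l, hl, .inr hyl⟩) ?_ l hl hyl
      rintro rfl
      exact hy.2 (hL.hasOut_root.mono Set.subset_union_right)
    · exact hL.conclusions y
        (mem_fv_of_subset Set.subset_union_right hy ⟨l, hl, .inr hyl⟩) l hl hyl
  acyclic := hK.acyclic_union hL.toIsFragment hg hcK hL.acyclic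

theorem fv_union_of_glueable (hz : z ∈ fv K) (hL : CorrectNet B L z)
    (hg : Glueable K L) : fv (K ∪ L) = (fv K \ {z}) ∪ fv L := by
  ext y
  simp only [Set.mem_union, Set.mem_sdiff, Set.mem_singleton_iff, mem_fv_iff (L := K ∪ L),
    hasIn_union, hasOut_union, not_or]
  constructor
  · rintro ⟨hi | hi, hK, hL'⟩
    · refine .inl ⟨mem_fv_iff.2 ⟨hi, hK⟩, ?_⟩
      rintro rfl
      exact hL' hL.hasOut_root
    · exact .inr (mem_fv_iff.2 ⟨hi, hL'⟩)
  · rintro (⟨hy, hyz⟩ | hy)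
    · refine ⟨.inl (mem_fv_iff.1 hy).1, hy.2, fun ho => ?_⟩
      obtain ⟨_, he, -, hi | ⟨hyL, -⟩⟩ := hg (.e y) hy.1 ho.mem_nodes
      · cases he
        exact hyz (hL.eq_root ho.mem_nodes hi)
      · cases he
        exact hyL.2 ho
    · refine ⟨.inr (mem_fv_iff.1 hy).1, fun ho => ?_, hy.2⟩
      obtain ⟨_, he, hyK, -⟩ := hg (.e y) ho.mem_nodes hy.1
      cases he
      exact hyK.2 ho

/-! ### Fragments at the root of values and applications -/

theorem correctionGraph_eq_self (h : ∀ a x s, .par a x s ∉ L) : correctionGraph B L = L := by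
  ext l
  constructor
  · rintro (h' | ⟨a, x, s, h', -⟩)
    exacts [h'.1.1, absurd h'.1 (h a x s)]
  · exact fun hl => .inl ⟨⟨hl, fun a x s hp => absurd hp (h a x s)⟩,
      fun a x s he => h a x s (he ▸ hl)⟩

theorem isFragment_weak : IsFragment B {.weak y} where
  finite := Set.finite_singleton _
  labels := by simp
  multiplicative a ha := by simp [nodes] at ha
  exponential_out x l hl k hk := by rw [hl, hk]; simp
  exponential_in x l hl k hk _ _ hne := absurd (hl.trans hk.symm) hne
  box_net := by simp
  box_correct := by simp
  border := by simp
  nesting := by simp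
  internal_closure := by simp
  subnet := by simp

/-- A dereliction below a link on its m-node. -/
theorem isFragment_head_der (ho : ∀ q, o = some q → q ≠ y) :
    IsFragment B {.head r a o, .der a y} where
  finite := by simp
  labels := by simp [eq_comm (b := Link.head _ _ _)]
  multiplicative b hb := by
    obtain rfl : b = a := by
      simp [mem_nodes_iff, hasOut_pair, hasIn_pair] at hb
      exact hb
    refine ⟨⟨.head r b o, by simp, ?_⟩, ⟨.der b y, by simp, ?_⟩⟩
    · rintro k ⟨rfl | rfl, hk⟩
      exacts [rfl, by simp at hk]
    · rintro k ⟨rfl | rfl, hk⟩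
      exacts [by simp at hk, rfl]
  exponential_out x l hl k hk hxl hxk := by
    rcases hl with rfl | rfl <;> rcases hk with rfl | rfl <;> simp at hxl hxk ⊢
  exponential_in x l hl k hk hxl hxk hne := by
    rcases hl with rfl | rfl <;> rcases hk with rfl | rfl <;> simp at hxl hxk hne
    · exact absurd hxk (ho x hxl)
    · exact absurd hxl (ho x hxk)
  box_net := by simp [eq_comm (b := Link.head _ _ _)]
  box_correct := by simp [eq_comm (b := Link.head _ _ _)]
  border := by simp [eq_comm (b := Link.head _ _ _)]
  nesting := by simp [eq_comm (b := Link.head _ _ _)]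
  internal_closure := by simp [eq_comm (b := Link.head _ _ _)]
  subnet := by simp [eq_comm (b := Link.head _ _ _)]

theorem acyclic_head_der (hry : r ≠ y) (ho : ∀ q, o = some q → q ≠ r) :
    Acyclic (correctionGraph B {.head r a o, .der a y}) := by
  rw [correctionGraph_eq_self (by simp [eq_comm (b := Link.head _ _ _)])]
  refine acyclic_pair (r := r) (a := a) (by simp) ?_ (by simp) (by simpa using hry) (by simp)
  simp only [Link.mem_tgt_head, reduceCtorEq, false_or, Node.e.injEq]
  rintro ⟨q, hq, rfl⟩
  exact ho _ hq rfl

theorem fv_head_der (hry : r ≠ y) (ho : ∀ q, o = some q → q ≠ r) :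
    fv {.head r a o, .der a y} = {z | z = y ∨ o = some z} := by
  ext z
  simp only [mem_fv_iff, hasIn_pair, hasOut_pair, Link.mem_tgt_head, Link.mem_src_head,
    Link.mem_src_der, Link.mem_tgt_der, Set.mem_ofPred_eq, reduceCtorEq, Node.e.injEq, false_or,
    or_false]
  constructor
  · rintro ⟨⟨q, hq, rfl⟩ | h, -⟩
    exacts [.inr hq, .inl h]
  · rintro (rfl | h)
    · exact ⟨.inr rfl, hry.symm⟩
    · exact ⟨.inl ⟨z, h, rfl⟩, ho z h⟩

theorem source_head_der (hry : r ≠ y) (ho : ∀ q, o = some q → q ≠ r) (x : E) :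
    (.e x ∈ nodes {.head r a o, .der a y} ∧ ¬ HasIn {.head r a o, .der a y} (.e x)) ↔ x = r := by
  simp only [mem_nodes_iff, hasIn_pair, hasOut_pair, Link.mem_tgt_head, Link.mem_src_head,
    Link.mem_src_der, Link.mem_tgt_der, reduceCtorEq, Node.e.injEq, false_or, or_false]
  constructor
  · rintro ⟨h | h, h'⟩
    exacts [h, absurd h h']
  · rintro rfl
    refine ⟨.inl rfl, ?_⟩
    rintro (⟨q, hq, rfl⟩ | h)
    exacts [ho _ hq rfl, hry h]

/-- A `⅋`-link with its box, below a link on its m-node. -/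
theorem isFragment_head_par (hK : CorrectNet B K p) (hbox : B a x p = K) (ha : .m a ∉ nodes K)
    (hr : .e r ∉ nodes K) (hx : x ∈ fv K) (hw : ∀ y ∈ fv K, .weak y ∈ K → y = x)
    (ho : ∀ q, o = some q → .e q ∉ nodes K) :
    IsFragment B ({.head r a o, .par a x p} ∪ K) := by
  have mem_par : ∀ {b y q}, Link.par b y q ∈ ({.head r a o, .par a x p} ∪ K : Set (Link E M)) →
      (b = a ∧ y = x ∧ q = p) ∨ .par b y q ∈ K := by
    rintro b y q ((h | h) | h)
    · exact absurd h.symm (by simp)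
    · exact .inl (by simpa using h)
    · exact .inr h
  have cases_par : ∀ {P : M → E → E → Prop}, P a x p → (∀ b y q, .par b y q ∈ K → P b y q) →
      ∀ b y q, Link.par b y q ∈ ({.head r a o, .par a x p} ∪ K : Set (Link E M)) → P b y q := by
    intro P h1 h2 b y q h
    rcases mem_par h with ⟨rfl, rfl, rfl⟩ | h
    exacts [h1, h2 _ _ _ h]
  have hpK : .e p ∈ nodes K := hK.root_mem
  have src_new : ∀ {l u}, l ∈ ({.head r a o, .par a x p} : Set (Link E M)) → u ∈ l.src →
      ¬ HasOut K u := by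
    rintro l u (rfl | rfl) hu hK'
    · obtain rfl := Link.mem_src_head.1 hu
      exact hr hK'.mem_nodes
    · rcases hu with rfl | rfl
      exacts [ha hK'.mem_nodes, hx.2 hK']
  have tgt_new : ∀ {l u}, l ∈ ({.head r a o, .par a x p} : Set (Link E M)) → u ∈ l.tgt →
      ¬ HasIn K u := by
    rintro l u (rfl | rfl) hu hK'
    · rcases Link.mem_tgt_head.1 hu with rfl | ⟨q, hq, rfl⟩
      exacts [ha hK'.mem_nodes, ho q hq hK'.mem_nodes]
    · obtain rfl := Link.mem_tgt_par.1 hu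
      exact hK.not_hasIn_root hK'
  have src_pair : ∀ {l k u}, l ∈ ({.head r a o, .par a x p} : Set (Link E M)) →
      k ∈ ({.head r a o, .par a x p} : Set (Link E M)) → u ∈ l.src → u ∈ k.src → l = k := by
    have hrx : r ≠ x := fun h => hr (h ▸ hx.1)
    rintro l k u (rfl | rfl) (rfl | rfl) hl hk
    · rfl
    · rw [Link.mem_src_head] at hl
      simp [hl, hrx] at hk
    · rw [Link.mem_src_head] at hk
      simp [hk, hrx] at hl
    · rfl
  have tgt_pair : ∀ {l k u}, l ∈ ({.head r a o, .par a x p} : Set (Link E M)) →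
      k ∈ ({.head r a o, .par a x p} : Set (Link E M)) → u ∈ l.tgt → u ∈ k.tgt → l = k := by
    rintro l k u (rfl | rfl) (rfl | rfl) hl hk
    · rfl
    · rw [Link.mem_tgt_par] at hk
      simp only [hk, Link.mem_tgt_head, reduceCtorEq, Node.e.injEq, false_or] at hl
      obtain ⟨q, hq, rfl⟩ := hl
      exact absurd hpK (ho _ hq)
    · rw [Link.mem_tgt_par] at hl
      simp only [hl, Link.mem_tgt_head, reduceCtorEq, Node.e.injEq, false_or] at hk
      obtain ⟨q, hq, rfl⟩ := hk
      exact absurd hpK (ho _ hq)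
    · rfl
  refine ⟨.union (by simp) hK.finite, ?_, ?_, ?_, ?_, cases_par (hbox ▸ hK.isNet) hK.box_net,
    cases_par (hbox ▸ hK.isCorrect) hK.box_correct, cases_par ?_ hK.border, ?_, ?_,
    cases_par ?_ ?_⟩
  · rintro b T ((h | h) | h)
    exacts [absurd h.symm (by simp), absurd h (by simp), hK.labels b T h]
  · intro b hb
    by_cases hbK : .m b ∈ nodes K
    · obtain ⟨⟨i, hi, hi'⟩, ⟨j, hj, hj'⟩⟩ := hK.multiplicative b hbK
      refine ⟨⟨i, ⟨.inr hi.1, hi.2⟩, ?_⟩, ⟨j, ⟨.inr hj.1, hj.2⟩, ?_⟩⟩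
      · rintro k ⟨hk | hk, hk'⟩
        exacts [absurd (hK.hasIn_m hbK) (tgt_new hk hk'), hi' _ ⟨hk, hk'⟩]
      · rintro k ⟨hk | hk, hk'⟩
        exacts [absurd (hK.hasOut_m hbK) (src_new hk hk'), hj' _ ⟨hk, hk'⟩]
    · obtain rfl : b = a := by
        rw [nodes_union] at hb
        have := hb.resolve_right hbK
        simp [mem_nodes_iff, hasOut_pair, hasIn_pair] at this
        exact this
      refine ⟨⟨.head r b o, by simp, ?_⟩, ⟨.par b x p, by simp, ?_⟩⟩
      · rintro k ⟨hk | hk, hk'⟩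
        exacts [tgt_pair hk (.inl rfl) hk' (by simp), absurd ⟨k, hk, .inr hk'⟩ hbK]
      · rintro k ⟨hk | hk, hk'⟩
        exacts [src_pair hk (.inr rfl) hk' (by simp), absurd ⟨k, hk, .inl hk'⟩ hbK]
  · rintro y l (hl | hl) k (hk | hk) hyl hyk
    · exact src_pair hl hk hyl hyk
    · exact absurd ⟨k, hk, hyk⟩ (src_new hl hyl)
    · exact absurd ⟨l, hl, hyl⟩ (src_new hk hyk)
    · exact hK.exponential_out y l hl k hk hyl hyk
  · rintro y l (hl | hl) k (hk | hk) hyl hyk hne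
    · exact absurd (tgt_pair hl hk hyl hyk) hne
    · exact absurd ⟨k, hk, hyk⟩ (tgt_new hl hyl)
    · exact absurd ⟨l, hl, hyl⟩ (tgt_new hk hyk)
    · exact hK.exponential_in y l hl k hk hyl hyk hne
  · rw [hbox]
    exact ⟨hx, fun y hy hne h => hne (hw y hy h)⟩
  · intro b y q c z t hp hq h1 h2
    rcases mem_par hp with ⟨rfl, rfl, rfl⟩ | hbK <;> rcases mem_par hq with ⟨h1a, h1b, h1c⟩ | hqK
    · subst h1a h1b h1c
      exact absurd subset_rfl h1
    · exact absurd (hbox ▸ hK.subnet _ _ _ hqK) h2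
    · subst h1a h1b h1c
      exact absurd (hbox ▸ hK.subnet _ _ _ hbK) h1
    · exact hK.nesting _ _ _ _ _ _ hbK hqK h1 h2
  · intro b y q hp z hz l hl hzl
    rcases mem_par hp with ⟨rfl, rfl, rfl⟩ | hp
    · rw [hbox] at hz ⊢
      have hi : HasIn K (.e z) := hz.elim (fun h => h.1) (by rintro rfl; exact (mem_fv_iff.1 hx).1)
      exact hl.resolve_left fun hl => tgt_new hl hzl hi
    · have hi : HasIn K (.e z) := hz.elim (fun h => h.1.mono (hK.subnet _ _ _ hp))
        (by rintro rfl; exact hK.var_hasIn hp)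
      exact hK.internal_closure _ _ _ hp z hz l (hl.resolve_left fun hl => tgt_new hl hzl hi) hzl
  · rw [hbox]; exact Set.subset_union_right
  · exact fun b y q h => (hK.subnet b y q h).trans Set.subset_union_right

theorem levelZero_head_par (hK : IsFragment B K) (hbox : B a x p = K) (ha : .m a ∉ nodes K)
    (hr : .e r ∉ nodes K) :
    levelZero B ({.head r a o, .par a x p} ∪ K) = {.head r a o, .par a x p} := by
  ext l
  constructor
  · rintro ⟨hl | hl, h⟩
    · exact hl
    · exact absurd (hbox ▸ hl) (h a x p (by simp))
  · have hlK : l ∈ ({.head r a o, .par a x p} : Set (Link E M)) → l ∉ K := by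
      rintro (rfl | rfl) h
      exacts [hr ⟨_, h, by simp⟩, ha ⟨_, h, by simp⟩]
    refine fun hl => ⟨.inl hl, ?_⟩
    rintro b y q ((h | h) | h) hlb
    · exact absurd h.symm (by simp)
    · have : b = a ∧ y = x ∧ q = p := by simpa using h
      obtain ⟨rfl, rfl, rfl⟩ := this
      exact hlK hl (hbox ▸ hlb)
    · exact hlK hl (hK.subnet _ _ _ h hlb)

theorem acyclic_head_par (hK : CorrectNet B K p) (hbox : B a x p = K) (ha : .m a ∉ nodes K)
    (hr : .e r ∉ nodes K)
    (ho : ∀ q, o = some q → q ≠ r) :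
    Acyclic (correctionGraph B ({.head r a o, .par a x p} ∪ K)) := by
  have hsub : correctionGraph B ({.head r a o, .par a x p} ∪ K) ⊆
      {.head r a o, .square a (fv K \ {x})} := by
    rintro l (⟨hl, hl'⟩ | ⟨b, y, q, hl, rfl⟩) <;>
      rw [levelZero_head_par hK.toIsFragment hbox ha hr] at hl
    · rcases hl with rfl | rfl
      exacts [.inl rfl, absurd rfl (hl' _ _ _)]
    · rcases hl with hl | hl
      · exact absurd hl.symm (by simp)
      · have : b = a ∧ y = x ∧ q = p := by simpa using hl
        obtain ⟨rfl, rfl, rfl⟩ := this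
        rw [hbox]; exact .inr rfl
  refine Acyclic.mono hsub (acyclic_pair (r := r) (a := a) (by simp) ?_ (by simp) ?_ (by simp))
  · simp only [Link.mem_tgt_head, reduceCtorEq, false_or, Node.e.injEq]
    rintro ⟨q, hq, rfl⟩
    exact ho _ hq rfl
  · rintro ⟨y, hy, he⟩
    cases he
    exact hr hy.1.1

theorem fv_head_par (hK : CorrectNet B K p) (hr : .e r ∉ nodes K) (hx : x ∈ fv K)
    (ho : ∀ q, o = some q → .e q ∉ nodes K ∧ q ≠ r) :
    fv ({.head r a o, .par a x p} ∪ K) = {z | z ∈ fv K \ {x} ∨ o = some z} := by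
  ext z
  simp only [mem_fv_iff, hasIn_union, hasOut_union, hasIn_pair, hasOut_pair, Link.mem_tgt_head,
    Link.mem_src_head, Link.mem_src_par, Link.mem_tgt_par, reduceCtorEq, Node.e.injEq, false_or,
    Set.mem_ofPred_eq, Set.mem_sdiff, Set.mem_singleton_iff]
  constructor
  · rintro ⟨(⟨q, hq, rfl⟩ | rfl) | hi, h⟩
    · exact .inr hq
    · exact absurd (.inr hK.hasOut_root) h
    · exact .inl ⟨⟨hi, fun h' => h (.inr h')⟩, fun h' => h (.inl (.inr h'))⟩
  · rintro (⟨⟨hi, h⟩, h'⟩ | h)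
    · refine ⟨.inr hi, ?_⟩
      rintro ((rfl | h'') | h'')
      exacts [hr hi.mem_nodes, h' h'', h h'']
    · refine ⟨.inl (.inl ⟨z, h, rfl⟩), ?_⟩
      rintro ((rfl | rfl) | h'')
      exacts [(ho _ h).2 rfl, (ho _ h).1 hx.1, (ho _ h).1 h''.mem_nodes]

theorem source_head_par (hK : CorrectNet B K p) (hr : .e r ∉ nodes K) (hx : x ∈ fv K)
    (ho : ∀ q, o = some q → .e q ∉ nodes K ∧ q ≠ r) (y : E) :
    (.e y ∈ nodes ({.head r a o, .par a x p} ∪ K) ∧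
      ¬ HasIn ({.head r a o, .par a x p} ∪ K) (.e y)) ↔ y = r := by
  simp only [nodes_union, Set.mem_union, mem_nodes_iff (L := {_, _}), hasIn_union, hasIn_pair,
    hasOut_pair, Link.mem_tgt_head, Link.mem_src_head, Link.mem_src_par, Link.mem_tgt_par,
    reduceCtorEq, Node.e.injEq, false_or]
  constructor
  · rintro ⟨((rfl | rfl) | h) | hyK, hi⟩
    · rfl
    · exact absurd (.inr (mem_fv_iff.1 hx).1) hi
    · exact absurd (.inl h) hi
    · obtain rfl := hK.eq_root hyK fun h => hi (.inr h)
      exact absurd (.inl (.inr rfl)) hi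
  · rintro rfl
    refine ⟨.inl (.inl (.inl rfl)), ?_⟩
    rintro ((⟨q, hq, rfl⟩ | rfl) | h)
    exacts [(ho _ hq).2 rfl, hr hK.root_mem, hr h.mem_nodes]

end Glueing

section Translation

variable {E M : Type*} {B : M → E → E → Set (Link E M)} {K L : Set (Link E M)} {r x y s q p : E}
  {a : M} {l : Link E M} {t : Term E} {X : Set E}

open Hyper

/-! ### Translations of terms are correct nets -/

/-- What is known of the translation of a term `t` with respect to `X`. -/
structure TranslationSpec (B : M → E → E → Set (Link E M)) (t : Term E) (X : Set E)
    (L : Set (Link E M)) (r : E) : Prop extends CorrectNet B L r where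
  fv_eq : fv L = t.fv ∪ X
  weak : ∀ y, Link.weak y ∈ L → y ∈ fv L → y ∈ X ∧ y ∉ t.fv

namespace TranslationSpec

theorem der_of_mem_fv (h : TranslationSpec B t X L r) (hy : y ∈ t.fv) (hl : l ∈ L)
    (hyl : .e y ∈ l.tgt) : ∃ a, l = .der a y := by
  have hyL : y ∈ fv L := h.fv_eq ▸ .inl hy
  rcases h.conclusions y hyL l hl hyl with h' | rfl
  exacts [h', absurd hy (h.weak y hl hyL).2]

theorem mem_fv_singleton (h : TranslationSpec B t {x} L r) : x ∈ fv L := h.fv_eq ▸ .inr rfl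

theorem eq_of_weak (h : TranslationSpec B t {x} L r) : ∀ y ∈ fv L, Link.weak y ∈ L → y = x :=
  fun y hy hw => (h.weak y hw hy).1

theorem fv_diff (h : TranslationSpec B t {x} L r) : fv L \ {x} = t.fv \ {x} := by
  rw [h.fv_eq]; simp

theorem var (hr : r ≠ x) : TranslationSpec B (.var x) ∅ {.bang r a, .der a x} r where
  toIsFragment := isFragment_head_der (o := none) (by simp)
  source := source_head_der (o := none) hr (by simp)
  conclusions y hy l hl hyl := by
    rcases hl with rfl | rfl
    · simp at hyl
    · simp at hyl; simp [hyl]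
  acyclic := acyclic_head_der (o := none) hr (by simp)
  fv_eq := by
    have := fv_head_der (a := a) (o := none) hr (by simp)
    simp only [Link.head] at this
    simp [this, Term.fv]
  weak := by simp

theorem lam (ht : TranslationSpec B t {x} L s) (hbox : B a x s = L)
    (ha : Node.m a ∉ nodes L) (hr : Node.e r ∉ nodes L) :
    TranslationSpec B (.lam x t) ∅ ({.bang r a, .par a x s} ∪ L) r := by
  have hfv : fv ({.bang r a, .par a x s} ∪ L) = fv L \ {x} := by
    have := fv_head_par (a := a) (o := none) ht.toCorrectNet hr ht.mem_fv_singleton (by simp)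
    simp only [Link.head, reduceCtorEq, or_false] at this
    exact this
  exact {
    toIsFragment := isFragment_head_par (o := none) ht.toCorrectNet hbox ha hr
      ht.mem_fv_singleton ht.eq_of_weak (by simp)
    source := source_head_par (o := none) ht.toCorrectNet hr ht.mem_fv_singleton (by simp)
    conclusions := by
      intro y hy l hl hyl
      rw [hfv] at hy
      rcases hl with (rfl | rfl) | hl
      · simp at hyl
      · obtain rfl : y = s := by simpa using hyl
        exact absurd hy.1 ht.root_notMem_fv
      · exact ht.conclusions y hy.1 l hl hyl
    acyclic := acyclic_head_par (o := none) ht.toCorrectNet hbox ha hr (by simp)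
    fv_eq := by rw [hfv, ht.fv_diff]; simp [Term.fv]
    weak := by
      rintro y ((h | h) | h) hy
      · cases h
      · cases h
      · rw [hfv] at hy
        exact absurd (ht.weak y h hy.1).1 hy.2 }

theorem varApp {s : Term E} (hs : TranslationSpec B s ∅ L q) (ha : Node.m a ∉ nodes L)
    (hr : Node.e r ∉ nodes L) (hry : r ≠ y) (hy : Node.e y ∈ nodes L → y ∈ s.fv) :
    TranslationSpec B (.varApp y s) ∅ ({.tens r a q, .der a y} ∪ L) r := by
  have hqr : q ≠ r := fun h => hr (h ▸ hs.root_mem)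
  have hqy : q ≠ y := by
    rintro rfl
    exact hs.root_notMem_fv (hs.fv_eq ▸ .inl (hy hs.root_mem))
  have hoy : ∀ q', some q = some q' → q' ≠ y := by simpa using hqy
  have hor : ∀ q', some q = some q' → q' ≠ r := by simpa using hqr
  have hfv : fv {.tens r a q, .der a y} = {z | z = y ∨ some q = some z} := fv_head_der hry hor
  have hqK : q ∈ fv {.tens r a q, .der a y} := by simp [hfv]
  have hg : Glueable {.tens r a q, .der a y} L := by
    intro u huK huL
    have : u = .e q ∨ u = .e y := by
      simp only [mem_nodes_iff, hasOut_pair, hasIn_pair, Link.mem_src_tens, Link.mem_src_der,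
        Link.mem_tgt_tens, Link.mem_tgt_der] at huK
      rcases huK with (rfl | rfl) | (rfl | h) | h
      exacts [absurd huL hr, absurd huL ha, absurd huL ha, .inl h, .inr h]
    rcases this with rfl | rfl
    · exact ⟨q, rfl, hqK, .inl hs.not_hasIn_root⟩
    · have hys := hy huL
      refine ⟨y, rfl, by simp [hfv], .inr ⟨hs.fv_eq ▸ .inl hys, ?_⟩⟩
      rintro l ((rfl | rfl) | hl) hyl
      · simp [hqy.symm] at hyl
      · exact ⟨a, rfl⟩
      · exact hs.der_of_mem_fv hys hl hyl
  exact {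
    CorrectNet.glue (isFragment_head_der (o := some q) hoy) (acyclic_head_der (o := some q) hry hor)
      hs.toCorrectNet hg (source_head_der (o := some q) hry hor) hr
      (mem_fv_iff.1 hqK).1 (by
        rintro z hz hzq l (rfl | rfl) hzl
        · simp [hzq] at hzl
        · simp at hzl
          simp [hzl]) with
    fv_eq := by
      rw [fv_union_of_glueable hqK hs.toCorrectNet hg, hfv, hs.fv_eq, Term.fv]
      ext z
      simp only [Set.mem_union, Set.mem_sdiff, Set.mem_ofPred_eq, Option.some.injEq,
        Set.mem_singleton_iff, Set.union_empty]
      constructor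
      · rintro (⟨h | h, h'⟩ | h)
        exacts [.inl h, absurd h.symm h', .inr h]
      · rintro (rfl | h)
        exacts [.inl ⟨.inl rfl, hqy.symm⟩, .inr h]
    weak := by
      rintro z ((h | h) | h) hz
      · cases h
      · cases h
      · exact absurd (hs.weak z h (mem_fv_of_subset Set.subset_union_right hz ⟨_, h, .inr rfl⟩)).1
          (by simp) }

theorem lamApp {s : Term E} (ht : TranslationSpec B t {x} K p) (hs : TranslationSpec B s ∅ L q)
    (hbox : B a x p = K) (ha : Node.m a ∉ nodes K ∪ nodes L) (hr : Node.e r ∉ nodes K ∪ nodes L)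
    (hshare : nodes K ∩ nodes L ⊆ Node.e '' ((t.fv \ {x}) ∩ s.fv)) :
    TranslationSpec B (.lamApp x t s) ∅ ({.tens r a q, .par a x p} ∪ (K ∪ L)) r := by
  have hqr : q ≠ r := fun h => hr (.inr (h ▸ hs.root_mem))
  have hqK : .e q ∉ nodes K := fun h => by
    obtain ⟨_, hy, he⟩ := hshare ⟨h, hs.root_mem⟩
    cases he
    exact hs.root_notMem_fv (hs.fv_eq ▸ .inl hy.2)
  have haK : Node.m a ∉ nodes K := fun h => ha (.inl h)
  have haL : Node.m a ∉ nodes L := fun h => ha (.inr h)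
  have hrK : Node.e r ∉ nodes K := fun h => hr (.inl h)
  have hrL : Node.e r ∉ nodes L := fun h => hr (.inr h)
  have hpL : .e p ∉ nodes L := fun h => by
    obtain ⟨_, hy, he⟩ := hshare ⟨ht.root_mem, h⟩
    cases he
    exact ht.root_notMem_fv (ht.fv_eq ▸ .inl hy.1.1)
  have hxL : .e x ∉ nodes L := fun h => by
    obtain ⟨_, hy, he⟩ := hshare ⟨ht.mem_fv_singleton.1, h⟩
    cases he
    exact hy.1.2 rfl
  have ho : ∀ q', some q = some q' → .e q' ∉ nodes K ∧ q' ≠ r := by simpa using ⟨hqK, hqr⟩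
  have hfv : fv ({.tens r a q, .par a x p} ∪ K) = {z | z ∈ fv K \ {x} ∨ some q = some z} :=
    fv_head_par ht.toCorrectNet hrK ht.mem_fv_singleton ho
  have hqF : q ∈ fv ({.tens r a q, .par a x p} ∪ K) := by simp [hfv]
  have hg : Glueable ({.tens r a q, .par a x p} ∪ K) L := by
    intro u huK huL
    have : u = .e q ∨ u ∈ nodes K := by
      simp only [nodes_union, Set.mem_union, mem_nodes_iff (L := {_, _}), hasOut_pair, hasIn_pair,
        Link.mem_src_tens, Link.mem_src_par, Link.mem_tgt_tens, Link.mem_tgt_par] at huK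
      rcases huK with ((rfl | rfl | rfl) | (rfl | h) | rfl) | h
      exacts [absurd huL hrL, absurd huL haL, absurd huL hxL, absurd huL haL, .inl h,
        absurd huL hpL, .inr h]
    rcases this with rfl | hu
    · exact ⟨q, rfl, hqF, .inl hs.not_hasIn_root⟩
    · obtain ⟨y, ⟨⟨hyt, hyx⟩, hys⟩, rfl⟩ := hshare ⟨hu, huL⟩
      have hyK : y ∈ fv K := ht.fv_eq ▸ .inl hyt
      refine ⟨y, rfl, by rw [hfv]; exact .inl ⟨hyK, hyx⟩, .inr ⟨hs.fv_eq ▸ .inl hys, ?_⟩⟩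
      rintro l (((rfl | rfl) | hl) | hl) hyl
      · obtain rfl : y = q := by simpa using hyl
        exact absurd hyK.1 hqK
      · obtain rfl : y = p := by simpa using hyl
        exact absurd hyK ht.root_notMem_fv
      · exact ht.der_of_mem_fv hyt hl hyl
      · exact hs.der_of_mem_fv hys hl hyl
  rw [← Set.union_assoc]
  exact {
    CorrectNet.glue (isFragment_head_par (o := some q) ht.toCorrectNet hbox haK hrK
        ht.mem_fv_singleton ht.eq_of_weak fun q hq => (ho q hq).1)
      (acyclic_head_par (o := some q) ht.toCorrectNet hbox haK hrK fun q hq => (ho q hq).2)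
      hs.toCorrectNet hg
      (source_head_par (o := some q) ht.toCorrectNet hrK ht.mem_fv_singleton ho) hrL
      (mem_fv_iff.1 hqF).1 (by
        intro z hz hzq l hl hzl
        have hz := hfv ▸ hz
        have hzK : z ∈ fv K := hz.elim (fun h => h.1) fun h => absurd (by simpa using h.symm) hzq
        rcases hl with (rfl | rfl) | hl
        · simp [hzq] at hzl
        · obtain rfl : z = p := by simpa using hzl
          exact absurd hzK ht.root_notMem_fv
        · exact ht.conclusions z hzK l hl hzl) with
    fv_eq := by
      rw [fv_union_of_glueable hqF hs.toCorrectNet hg, hfv, ht.fv_diff, hs.fv_eq, Term.fv]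
      ext z
      simp only [Set.mem_union, Set.mem_sdiff, Set.mem_ofPred_eq, Option.some.injEq,
        Set.mem_singleton_iff, Set.union_empty]
      constructor
      · rintro (⟨h | h, h'⟩ | h)
        exacts [.inl h, absurd h.symm h', .inr h]
      · rintro (h | h)
        · refine .inl ⟨.inl h, ?_⟩
          rintro rfl
          exact hqK (ht.fv_eq ▸ Or.inl h.1 : z ∈ fv K).1
        · exact .inr h
    weak := by
      rintro z (((h | h) | h) | h) hz
      · cases h
      · cases h
      · have hzF := mem_fv_of_subset Set.subset_union_left hz ⟨_, .inr h, .inr rfl⟩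
        rw [hfv] at hzF
        rcases hzF with hzF | hzF
        · exact absurd (ht.weak z h hzF.1).1 hzF.2
        · obtain rfl : q = z := by simpa using hzF
          exact absurd ⟨_, h, .inr rfl⟩ hqK
      · exact absurd (hs.weak z h (mem_fv_of_subset Set.subset_union_right hz ⟨_, h, .inr rfl⟩)).1
          (by simp) }

theorem sub {u : Term E} (ht : TranslationSpec B t {x} K r) (hu : TranslationSpec B u ∅ L x)
    (hshare : nodes K ∩ nodes L ⊆ Node.e '' ({x} ∪ ((t.fv \ {x}) ∩ u.fv))) :
    TranslationSpec B (.sub t x u) ∅ (K ∪ L) r := by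
  have hx := ht.mem_fv_singleton
  have hg : Glueable K L := by
    intro v hvK hvL
    obtain ⟨y, rfl | ⟨⟨hyt, hyx⟩, hyu⟩, rfl⟩ := hshare ⟨hvK, hvL⟩
    · exact ⟨y, rfl, hx, .inl hu.not_hasIn_root⟩
    · refine ⟨y, rfl, ht.fv_eq ▸ .inl hyt, .inr ⟨hu.fv_eq ▸ .inl hyu, ?_⟩⟩
      rintro l (hl | hl) hyl
      · exact ht.der_of_mem_fv hyt hl hyl
      · exact hu.der_of_mem_fv hyu hl hyl
  exact {
    CorrectNet.glue ht.toIsFragment ht.acyclic hu.toCorrectNet hg ht.source (by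
        intro hrL
        obtain ⟨_, h, he⟩ := hshare ⟨ht.root_mem, hrL⟩
        cases he
        refine ht.root_notMem_fv ?_
        rcases h with rfl | h
        exacts [hx, ht.fv_eq ▸ .inl h.1.1])
      (mem_fv_iff.1 hx).1 (fun y hy _ => ht.conclusions y hy) with
    fv_eq := by
      rw [fv_union_of_glueable hx hu.toCorrectNet hg, ht.fv_diff, hu.fv_eq, Term.fv]; simp
    weak := by
      rintro z (h | h) hz
      · have hzK := mem_fv_of_subset Set.subset_union_left hz ⟨_, h, .inr rfl⟩
        obtain rfl := (ht.weak z h hzK).1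
        exact absurd (hu.hasOut_root.mono Set.subset_union_right) hz.2
      · exact absurd (hu.weak z h (mem_fv_of_subset Set.subset_union_right hz ⟨_, h, .inr rfl⟩)).1
          (by simp) }

theorem addWeak (ht : TranslationSpec B t X L r) (hy : y ∉ t.fv) (hfresh : Node.e y ∉ nodes L) :
    TranslationSpec B t (X ∪ {y}) ({.weak y} ∪ L) r := by
  have hny : ∀ u ∈ nodes {(.weak y : Link E M)}, u = .e y := by
    intro u hu
    simpa [mem_nodes_iff, hasIn_singleton, hasOut_singleton] using hu
  have hg : Glueable {.weak y} L := fun u hu huL => absurd (hny u hu ▸ huL) hfresh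
  have hfv : fv ({.weak y} ∪ L) = fv L ∪ {y} := by
    ext z
    simp only [mem_fv_iff, hasIn_union, hasOut_union, hasIn_singleton, hasOut_singleton,
      Link.mem_tgt_weak, Node.e.injEq, Link.mem_src_weak, false_or, Set.mem_union,
      Set.mem_singleton_iff]
    constructor
    · rintro ⟨h | h, h'⟩
      exacts [.inr h, .inl ⟨h, h'⟩]
    · rintro (h | rfl)
      exacts [⟨.inr h.1, h.2⟩, ⟨.inl rfl, fun h => hfresh h.mem_nodes⟩]
  exact {
    isFragment_weak.union ht.toIsFragment hg with
    source := by
      intro x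
      rw [nodes_union, hasIn_union, hasIn_singleton]
      constructor
      · rintro ⟨hx | hx, hi⟩
        · exact absurd (.inl (hny _ hx)) hi
        · exact ht.eq_root hx fun h => hi (.inr h)
      · rintro rfl
        refine ⟨.inr ht.root_mem, ?_⟩
        rintro (h | h)
        exacts [hfresh (h ▸ ht.root_mem), ht.not_hasIn_root h]
    conclusions := by
      rintro z hz l (rfl | hl) hzl
      · obtain rfl : z = y := by simpa using hzl
        exact .inr rfl
      · exact ht.conclusions z (mem_fv_of_subset Set.subset_union_right hz ⟨l, hl, .inr hzl⟩)
          l hl hzl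
    acyclic := isFragment_weak.acyclic_union ht.toIsFragment hg (by
      rw [correctionGraph_eq_self (by simp)]
      intro u hu
      obtain ⟨v, ⟨l, rfl, hv, -⟩, -⟩ := Relation.TransGen.head'_iff.1 hu
      exact hv) ht.acyclic
    fv_eq := by rw [hfv, ht.fv_eq, Set.union_assoc]
    weak := by
      rintro z (h | h) hz
      · cases h
        exact ⟨.inr rfl, hy⟩
      · obtain ⟨h1, h2⟩ := ht.weak z h (mem_fv_of_subset Set.subset_union_right hz ⟨_, h, .inr rfl⟩)
        exact ⟨.inl h1, h2⟩ }

theorem skip (ht : TranslationSpec B t X L r) (hy : y ∈ t.fv) :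
    TranslationSpec B t (X ∪ {y}) L r where
  toCorrectNet := ht.toCorrectNet
  fv_eq := by
    rw [ht.fv_eq, ← Set.union_assoc, Set.union_singleton, Set.insert_eq_of_mem (.inl hy)]
  weak z h hz := ⟨.inl (ht.weak z h hz).1, (ht.weak z h hz).2⟩

end TranslationSpec

theorem Translates.spec (h : Translates B t X L r) : TranslationSpec B t X L r := by
  induction h with
  | var x r a hr => exact .var hr
  | lam x r s a t L _ hbox ha hr ih => exact ih.lam hbox ha hr
  | varApp y r q a s L _ ha hr hry hy ih => exact ih.varApp ha hr hry hy
  | lamApp x r p q a t s K L _ _ hbox ha hr hshare iht ihs =>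
    exact iht.lamApp ihs hbox ha hr hshare
  | sub x r t u K L _ _ hshare iht ihu => exact iht.sub ihu hshare
  | weak y r t X L _ hy hfresh ih => exact ih.addWeak hy hfresh
  | skip y r t X L _ hy ih => exact ih.skip hy

end Translation

section Spines

variable {E M : Type*} {B : M → E → E → Set (Link E M)} {C L : Set (Link E M)}
  {r x y z s q : E} {a : M} {u : Node E M} {k l : Link E M} {o : Option E} {t : Term E}

open Hyper

/-! ### Links at level zero -/

/-- A relation without cycles whose left field is finite is well-founded. -/
theorem wellFounded_of_transGen_irrefl {α : Type*} {R : α → α → Prop} {S : Set α}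
    (hS : S.Finite) (hR : ∀ u v, R u v → u ∈ S) (h : ∀ u, ¬ Relation.TransGen R u u) :
    WellFounded R := by
  refine Subrelation.wf (r := InvImage (· < ·) fun v => {u | Relation.TransGen R u v}.ncard) ?_
    (InvImage.wf _ Nat.lt_wfRel.wf)
  intro u v huv
  refine Set.ncard_lt_ncard ⟨fun w hw => hw.tail huv, fun hc => h u (hc (.single huv))⟩ ?_
  refine hS.subset fun w hw => ?_
  obtain ⟨v', hwv, -⟩ := Relation.TransGen.head'_iff.1 hw
  exact hR _ _ hwv

namespace IsFragment

theorem finite_nodes (h : IsFragment B L) : (nodes L).Finite := by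
  have : nodes L = ⋃ l ∈ L, (l.src ∪ l.tgt) := by ext; simp [nodes]
  rw [this]
  refine h.finite.biUnion fun l hl => ?_
  cases l with
  | square a T => exact absurd hl (h.labels a T)
  | _ => simp [Link.src, Link.tgt]

theorem wellFounded_step (h : IsFragment B L) (hc : Acyclic (correctionGraph B L)) :
    WellFounded (Step (correctionGraph B L)) :=
  wellFounded_of_transGen_irrefl h.finite_nodes
    (fun _ _ ⟨l, hl, hu, _⟩ => h.nodes_correctionGraph_subset ⟨l, hl, .inl hu⟩) hc

theorem wellFounded_step_swap (h : IsFragment B L) (hc : Acyclic (correctionGraph B L)) :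
    WellFounded (Function.swap (Step (correctionGraph B L))) :=
  wellFounded_of_transGen_irrefl h.finite_nodes
    (fun _ _ ⟨l, hl, _, hu⟩ => h.nodes_correctionGraph_subset ⟨l, hl, .inr hu⟩)
    fun u hu => hc u (Relation.transGen_swap.1 hu)

theorem hasOut_box_root (h : IsFragment B L) (hp : .par a x s ∈ L) :
    HasOut (B a x s) (.e s) := by
  have : .e s ∈ nodes (B a x s) ∧ ¬ HasIn (B a x s) (.e s) := by
    cases h.box_net a x s hp; assumption
  exact (mem_nodes_iff.1 this.1).resolve_right this.2

theorem exists_eq_head (hz : .e z ∈ l.src)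
    (hp : ∀ a x s, l ≠ .par a x s) : ∃ a o, l = .head z a o := by
  cases l with
  | bang x a => exact ⟨a, none, by simpa [Link.head, eq_comm] using hz⟩
  | tens x a y => exact ⟨a, some y, by simpa [Link.head, eq_comm] using hz⟩
  | der a x => simp at hz
  | weak x => simp at hz
  | par a x s => exact absurd rfl (hp _ _ _)
  | square a T => simp at hz

/-- The e-target of a link at level `0` that is not a `⅋`-link has its outgoing link at
level `0`. -/
theorem exists_head_of_mem_tgt (h : IsFragment B L) (hl : l ∈ levelZero B L)
    (hlp : ∀ a x s, l ≠ .par a x s) (hyl : .e y ∈ l.tgt) (ho : HasOut L (.e y)) :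
    ∃ a o, .head y a o ∈ levelZero B L := by
  obtain ⟨k, hk, hyk⟩ := ho
  have hvar : ∀ a x s, k ≠ .par a x s := by
    rintro a x s rfl
    obtain rfl : y = x := by simpa using hyk
    exact hl.2 _ _ _ hk (h.internal_closure _ _ _ hk y (.inr rfl) l hl.1 hyl)
  obtain ⟨a, o, rfl⟩ := exists_eq_head hyk hvar
  refine ⟨a, o, hk, fun b x s hp hkb => ?_⟩
  by_cases hi : HasIn (B b x s) (.e y)
  · exact hl.2 _ _ _ hp (h.internal_closure _ _ _ hp y (.inl ⟨hi, ⟨_, hkb, hyk⟩⟩) l hl.1 hyl)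
  · obtain rfl := h.eq_root_box hp ⟨_, hkb, .inl hyk⟩ hi
    exact hlp _ _ _ (h.in_unique_e (x := y) hp hl.1 rfl hyl (by simp)).symm

/-- A free variable of a box at level `0` other than the variable of its `⅋`-link has its outgoing
link at level `0`. -/
theorem exists_head_of_mem_fv_box (h : IsFragment B L) (hp : .par a x s ∈ levelZero B L)
    (hy : y ∈ fv (B a x s)) (hyx : y ≠ x) (ho : HasOut L (.e y)) :
    ∃ a o, .head y a o ∈ levelZero B L := by
  obtain ⟨k, hk, hyk⟩ := ho
  have h0 : k ∈ levelZero B L := by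
    refine (h.levelZero_or_outer hk).resolve_right ?_
    rintro ⟨b, z, q, hq, hkb⟩
    have hne : ¬ (a = b ∧ x = z ∧ s = q) := by
      rintro ⟨rfl, rfl, rfl⟩
      exact hy.2 ⟨k, hkb, hyk⟩
    obtain ⟨_, he, -, hyb⟩ := h.box_inter (u := .e y) hp hq hne hy.1 ⟨k, hkb, .inl hyk⟩
    cases he
    exact hyb.2 ⟨k, hkb, hyk⟩
  have hvar : ∀ a x s, k ≠ .par a x s := by
    rintro b z q rfl
    obtain rfl : y = z := by simpa using hyk
    obtain ⟨l, hl, hyl⟩ := (mem_fv_iff.1 hy).1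
    have hlb := h.internal_closure _ _ _ hk y (.inr rfl) l (h.subnet _ _ _ hp.1 hl) hyl
    exact hyx (h.box_disjoint hp h0 hl hlb).2.1.symm
  obtain ⟨a, o, rfl⟩ := exists_eq_head hyk hvar
  exact ⟨a, o, h0⟩

/-- The m-node of a link at level `0` has its outgoing link at level `0`. -/
theorem levelZero_of_m (h : IsFragment B L) (hl : l ∈ levelZero B L) (hal : .m a ∈ l.tgt)
    (hk : k ∈ L) (hak : .m a ∈ k.src) : k ∈ levelZero B L := by
  refine ⟨hk, fun b x s hp hkb => ?_⟩
  obtain ⟨j, hj, haj⟩ := (h.box_fragment hp).hasIn_m ⟨k, hkb, .inl hak⟩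
  have := h.in_unique_m hl.1 (h.subnet _ _ _ hp hj) hal haj
  exact hl.2 _ _ _ hp (this ▸ hj)

theorem box_correctNet (h : IsFragment B L) (hp : .par a x s ∈ L) :
    CorrectNet B (B a x s) s :=
  correctNet_iff.2 ⟨h.box_net _ _ _ hp, h.box_correct _ _ _ hp⟩

end IsFragment

/-! ### Spines -/

/-- A node at which the net can be cut into an explicit substitution: an e-node with its outgoing
link at level `0` and with incoming derelictions or weakenings only. -/
def IsCut (B : M → E → E → Set (Link E M)) (L : Set (Link E M)) (z : E) : Prop :=
  (∃ a o, .head z a o ∈ levelZero B L) ∧ HasIn L (.e z) ∧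
    ∀ l ∈ L, .e z ∈ l.tgt → (∃ a, l = .der a z) ∨ l = .weak z

/-- The subnet `C` of `L` is the translation of the term `t` with root `z`; its free variables are
free in `L`, and links of `L` enter it through its root and its free variables only. -/
structure IsSpine (B : M → E → E → Set (Link E M)) (L C : Set (Link E M)) (t : Term E) (z : E) :
    Prop where
  subset : C ⊆ L
  translates : Translates B t ∅ C z
  fv_subset : fv C ⊆ fv L
  closed : ∀ y, HasIn C (.e y) → HasOut C (.e y) → ∀ l ∈ L, .e y ∈ l.tgt → l ∈ C
  levelZero_subset : levelZero B C ⊆ levelZero B L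

namespace IsSpine

theorem correctNet (hC : IsSpine B L C t z) : CorrectNet B C z := hC.translates.spec.toCorrectNet

/-- No link leaves the subnet of a spine. -/
theorem mem_of_src (hC : IsSpine B L C t z) (h : IsFragment B L) (hu : u ∈ nodes C) (hk : k ∈ L)
    (huk : u ∈ k.src) : k ∈ C := by
  have : HasOut C u := by
    cases u with
    | m a => exact hC.correctNet.hasOut_m hu
    | e y =>
      by_contra ho
      exact (hC.fv_subset ⟨hu, ho⟩).2 ⟨k, hk, huk⟩
  obtain ⟨l, hl, hul⟩ := this
  exact h.out_unique (hC.subset hl) hk hul huk ▸ hl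

theorem mem_of_tgt_m (hC : IsSpine B L C t z) (h : IsFragment B L) (ha : .m a ∈ nodes C)
    (hk : k ∈ L) (hak : .m a ∈ k.tgt) : k ∈ C := by
  obtain ⟨l, hl, hul⟩ := hC.correctNet.hasIn_m ha
  exact h.in_unique_m (hC.subset hl) hk hul hak ▸ hl

/-- A box at level `0` that meets a spine is contained in it. -/
theorem par_mem_of_mem_box (hC : IsSpine B L C t z) (h : IsFragment B L)
    (hp : .par a x s ∈ levelZero B L) (hl : l ∈ B a x s) (hlC : l ∈ C) : .par a x s ∈ C := by
  rcases hC.correctNet.levelZero_or_outer hlC with h0 | ⟨b, y, q, hq, hlb⟩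
  · exact absurd hl ((hC.levelZero_subset h0).2 _ _ _ hp.1)
  · obtain ⟨rfl, rfl, rfl⟩ := h.box_disjoint hp (hC.levelZero_subset hq) hl hlb
    exact hq.1

end IsSpine

theorem IsSpine.head_der (hz : .head z a none ∈ levelZero B L)
    (hy : .der a y ∈ levelZero B L) (hyL : y ∈ fv L) :
    IsSpine B L {.bang z a, .der a y} (.var y) z where
  subset := by
    rintro l (rfl | rfl)
    exacts [hz.1, hy.1]
  translates := .var y z a (by rintro rfl; exact hyL.2 ⟨_, hz.1, rfl⟩)
  fv_subset w hw := by
    obtain ⟨hi, -⟩ := mem_fv_iff.1 hw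
    rcases hasIn_pair.1 hi with hi | hi
    · simp at hi
    · obtain rfl : w = y := by simpa using hi
      exact hyL
  closed w hi ho := by
    rcases hasIn_pair.1 hi with hi | hi
    · simp at hi
    · obtain rfl : w = y := by simpa using hi
      refine absurd (ho.mono ?_) hyL.2
      rintro l (rfl | rfl)
      exacts [hz.1, hy.1]
  levelZero_subset := by
    rintro l ⟨rfl | rfl, -⟩
    exacts [hz, hy]

/-- The source `z` of a link at level `0` on the m-node of a `⅋`-link does not belong to the box
of the latter, by acyclicity of the correction graph. -/
theorem CorrectNet.notMem_box_of_head (h : CorrectNet B L r) (hz : .head z a o ∈ levelZero B L)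
    (hp : .par a x s ∈ levelZero B L) : .e z ∉ nodes (B a x s) := by
  intro hzb
  have hfv : z ∈ fv (B a x s) := by
    refine ⟨hzb, ?_⟩
    rintro ⟨l, hl, hzl⟩
    have := h.out_unique (h.subnet _ _ _ hp.1 hl) hz.1 hzl (by simp)
    exact hz.2 _ _ _ hp.1 (this ▸ hl)
  have hzx : z ≠ x := by
    rintro rfl
    exact absurd (h.out_unique (u := .e z) hz.1 hp.1 (by simp) (by simp)) (by simp)
  refine h.acyclic (.e z) (.tail (b := .m a) (.single ?_) ?_)
  · exact ⟨_, mem_correctionGraph_of_ne_par hz (by simp), by simp, by simp⟩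
  · exact ⟨_, square_mem_correctionGraph hp, by simp, ⟨z, ⟨hfv, hzx⟩, rfl⟩⟩

theorem CorrectNet.m_notMem_box (h : CorrectNet B L r) (hz : .head z a o ∈ levelZero B L)
    (hp : .par a x s ∈ L) : .m a ∉ nodes (B a x s) := by
  intro ha
  obtain ⟨l, hl, hal⟩ := (h.box_fragment hp).hasIn_m ha
  have := h.in_unique_m (h.subnet _ _ _ hp hl) hz.1 hal (by simp)
  exact hz.2 _ _ _ hp (this ▸ hl)

theorem IsSpine.head_par (h : CorrectNet B L r) (hz : .head z a none ∈ levelZero B L)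
    (hp : .par a x s ∈ levelZero B L) (ht : Translates B t {x} (B a x s) s)
    (hfv : ∀ y ∈ fv (B a x s), y ≠ x → y ∈ fv L) :
    IsSpine B L ({.bang z a, .par a x s} ∪ B a x s) (.lam x t) z := by
  have hsub : {.bang z a, .par a x s} ∪ B a x s ⊆ L := by
    rintro l ((rfl | rfl) | hl)
    exacts [hz.1, hp.1, h.subnet _ _ _ hp.1 hl]
  have hzb := h.notMem_box_of_head hz hp
  refine ⟨hsub, .lam x z s a t _ ht rfl (h.m_notMem_box hz hp.1) hzb, ?_, ?_, ?_⟩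
  · intro w hw
    have hi := (mem_fv_iff.1 hw).1
    rw [hasIn_union, hasIn_pair] at hi
    rcases hi with (hi | hi) | hi
    · simp at hi
    · obtain rfl : w = s := by simpa using hi
      exact absurd ((h.hasOut_box_root hp.1).mono Set.subset_union_right) hw.2
    · refine hfv w (mem_fv_of_subset Set.subset_union_right hw hi.mem_nodes) ?_
      rintro rfl
      exact hw.2 ⟨.par a w s, by simp, by simp⟩
  · intro w hi ho l hl hwl
    rw [hasIn_union, hasIn_pair] at hi
    rw [hasOut_union, hasOut_pair] at ho
    rcases hi with (hi | hi) | hi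
    · simp at hi
    · obtain rfl : w = s := by simpa using hi
      rw [← h.in_unique_e (x := w) hp.1 hl (by simp) hwl (by simp)]
      simp
    · refine .inr (h.internal_closure _ _ _ hp.1 w ?_ l hl hwl)
      rcases ho with (ho | ho) | ho
      · obtain rfl : w = z := by simpa using ho
        exact absurd hi.mem_nodes hzb
      · exact .inr (by simpa using ho)
      · exact .inl ⟨hi, ho⟩
  · rintro l ⟨(rfl | rfl) | hl, hl'⟩
    exacts [hz, hp, absurd hl (hl' a x s (by simp))]

/-- The links on the root of an application do not touch the net of its argument. -/
theorem IsSpine.fresh (h : CorrectNet B L r) (hz : .tens z a q ∈ L) (hC : IsSpine B L C t q) :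
    .e z ∉ nodes C ∧ .m a ∉ nodes C := by
  have hn : .tens z a q ∉ C := fun hm => hC.correctNet.not_hasIn_root ⟨_, hm, by simp⟩
  exact ⟨fun hm => hn (hC.mem_of_src h.toIsFragment hm hz (by simp)),
    fun hm => hn (hC.mem_of_tgt_m h.toIsFragment hm hz (by simp))⟩

theorem IsSpine.head_der_app (h : CorrectNet B L r) (hz : .head z a (some q) ∈ levelZero B L)
    (hy : .der a y ∈ levelZero B L) (hyL : y ∈ fv L) (hC : IsSpine B L C t q) :
    IsSpine B L ({.tens z a q, .der a y} ∪ C) (.varApp y t) z := by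
  have hsub : {.tens z a q, .der a y} ∪ C ⊆ L := by
    rintro l ((rfl | rfl) | hl)
    exacts [hz.1, hy.1, hC.subset hl]
  obtain ⟨hzC, haC⟩ := hC.fresh h hz.1
  refine ⟨hsub, .varApp y z q a t C hC.translates haC hzC ?_ ?_, ?_, ?_, ?_⟩
  · rintro rfl
    exact hyL.2 ⟨_, hz.1, rfl⟩
  · intro hyC
    have := mem_fv_of_subset hC.subset hyL hyC
    rwa [hC.translates.spec.fv_eq, Set.union_empty] at this
  · intro w hw
    have hi := (mem_fv_iff.1 hw).1
    rw [hasIn_union, hasIn_pair] at hi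
    rcases hi with (hi | hi) | hi
    · obtain rfl : w = q := by simpa using hi
      exact absurd (hC.correctNet.hasOut_root.mono Set.subset_union_right) hw.2
    · obtain rfl : w = y := by simpa using hi
      exact hyL
    · exact hC.fv_subset (mem_fv_of_subset Set.subset_union_right hw hi.mem_nodes)
  · intro w hi ho l hl hwl
    rw [hasIn_union, hasIn_pair] at hi
    have hoL := ho.mono hsub
    rw [hasOut_union, hasOut_pair] at ho
    rcases hi with (hi | hi) | hi
    · obtain rfl : w = q := by simpa using hi
      rw [← h.in_unique_e (x := w) hz.1 hl (by simp) hwl (by simp)]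
      exact .inl (.inl rfl)
    · obtain rfl : w = y := by simpa using hi
      exact absurd hoL hyL.2
    · refine .inr (hC.closed w hi ?_ l hl hwl)
      refine ho.resolve_left ?_
      rintro (ho | ho)
      · obtain rfl : w = z := by simpa using ho
        exact hzC hi.mem_nodes
      · simp at ho
  · rintro l ⟨(rfl | rfl) | hl, hl'⟩
    exacts [hz, hy, hC.levelZero_subset ⟨hl, fun b w v hb => hl' b w v (.inr hb)⟩]

theorem IsSpine.head_par_app {t' : Term E} (h : CorrectNet B L r)
    (hz : .head z a (some q) ∈ levelZero B L)
    (hp : .par a x s ∈ levelZero B L) (ht : Translates B t' {x} (B a x s) s)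
    (hfv : ∀ y ∈ fv (B a x s), y ≠ x → y ∈ fv L) (hC : IsSpine B L C t q) :
    IsSpine B L ({.tens z a q, .par a x s} ∪ (B a x s ∪ C)) (.lamApp x t' t) z := by
  have hsub : {.tens z a q, .par a x s} ∪ (B a x s ∪ C) ⊆ L := by
    rintro l ((rfl | rfl) | (hl | hl))
    exacts [hz.1, hp.1, h.subnet _ _ _ hp.1 hl, hC.subset hl]
  have hzb := h.notMem_box_of_head hz hp
  have hab := h.m_notMem_box hz hp.1
  obtain ⟨hzC, haC⟩ := hC.fresh h hz.1
  have hpC : .par a x s ∉ C := fun hm => haC ⟨_, hm, by simp⟩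
  have hxC : .e x ∉ nodes C := fun hm =>
    hpC (hC.mem_of_src h.toIsFragment hm hp.1 (by simp))
  have hdisj : ∀ l ∈ B a x s, l ∉ C := fun l hl hlC =>
    hpC (hC.par_mem_of_mem_box h.toIsFragment hp hl hlC)
  -- A shared node has no outgoing link: such a link would lie in both parts.
  have hshare : ∀ u ∈ nodes (B a x s), u ∈ nodes C →
      ∃ y, u = .e y ∧ y ≠ x ∧ y ∈ fv (B a x s) ∧ y ∈ fv C := by
    intro u hub huC
    have hnb : ¬ HasOut (B a x s) u := by
      rintro ⟨k, hk, huk⟩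
      exact hdisj k hk (hC.mem_of_src h.toIsFragment huC (h.subnet _ _ _ hp.1 hk) huk)
    cases u with
    | m b => exact absurd ((h.box_fragment hp.1).hasOut_m hub) hnb
    | e y =>
      have hyx : y ≠ x := by rintro rfl; exact hxC huC
      have hyL := hfv y ⟨hub, hnb⟩ hyx
      exact ⟨y, rfl, hyx, ⟨hub, hnb⟩, mem_fv_of_subset hC.subset hyL huC⟩
  refine ⟨hsub, .lamApp x z s q a t' t _ C ht hC.translates rfl ?_ ?_ ?_, ?_, ?_, ?_⟩
  · rintro (hm | hm)
    exacts [hab hm, haC hm]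
  · rintro (hm | hm)
    exacts [hzb hm, hzC hm]
  · rintro u ⟨hub, huC⟩
    obtain ⟨y, rfl, hyx, hyb, hyC⟩ := hshare u hub huC
    rw [ht.spec.fv_eq] at hyb
    rw [hC.translates.spec.fv_eq, Set.union_empty] at hyC
    exact ⟨y, ⟨⟨hyb.resolve_right hyx, hyx⟩, hyC⟩, rfl⟩
  · intro w hw
    have hi := (mem_fv_iff.1 hw).1
    rw [hasIn_union, hasIn_pair, hasIn_union] at hi
    rcases hi with (hi | hi) | (hi | hi)
    · obtain rfl : w = q := by simpa using hi
      exact absurd (hC.correctNet.hasOut_root.mono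
        (Set.subset_union_right.trans Set.subset_union_right)) hw.2
    · obtain rfl : w = s := by simpa using hi
      exact absurd ((h.hasOut_box_root hp.1).mono
        (Set.subset_union_left.trans Set.subset_union_right)) hw.2
    · refine hfv w (mem_fv_of_subset (Set.subset_union_left.trans Set.subset_union_right) hw
        hi.mem_nodes) ?_
      rintro rfl
      exact hw.2 ⟨.par a w s, by simp, by simp⟩
    · exact hC.fv_subset (mem_fv_of_subset (Set.subset_union_right.trans Set.subset_union_right) hw
        hi.mem_nodes)
  · intro w hi ho l hl hwl
    rw [hasIn_union, hasIn_pair, hasIn_union] at hi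
    rw [hasOut_union, hasOut_pair, hasOut_union] at ho
    rcases hi with (hi | hi) | (hi | hi)
    · obtain rfl : w = q := by simpa using hi
      rw [← h.in_unique_e (x := w) hz.1 hl (by simp) hwl (by simp)]
      exact .inl (.inl rfl)
    · obtain rfl : w = s := by simpa using hi
      rw [← h.in_unique_e (x := w) hp.1 hl (by simp) hwl (by simp)]
      simp
    · refine .inr (.inl (h.internal_closure _ _ _ hp.1 w ?_ l hl hwl))
      rcases ho with (ho | ho) | (ho | ho)
      · obtain rfl : w = z := by simpa using ho
        exact absurd hi.mem_nodes hzb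
      · exact .inr (by simpa using ho)
      · exact .inl ⟨hi, ho⟩
      · obtain ⟨_, he, -, -, hwC⟩ := hshare _ hi.mem_nodes ho.mem_nodes
        cases he
        exact absurd ho hwC.2
    · refine .inr (.inr (hC.closed w hi ?_ l hl hwl))
      rcases ho with (ho | ho) | (ho | ho)
      · obtain rfl : w = z := by simpa using ho
        exact absurd hi.mem_nodes hzC
      · obtain rfl : w = x := by simpa using ho
        exact absurd hi.mem_nodes hxC
      · obtain ⟨_, he, -, hwb, -⟩ := hshare _ ho.mem_nodes hi.mem_nodes
        cases he
        exact absurd ho hwb.2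
      · exact ho
  · rintro l ⟨(rfl | rfl) | (hl | hl), hl'⟩
    exacts [hz, hp, absurd hl (hl' a x s (by simp)),
      hC.levelZero_subset ⟨hl, fun b w v hb => hl' b w v (.inr (.inr hb))⟩]

/-- One incoming dereliction or weakening suffices for a cut, as it excludes incoming links of
other kinds. -/
theorem CorrectNet.isCut_of_mem_tgt (h : CorrectNet B L r)
    (hy : ∃ a o, .head y a o ∈ levelZero B L) (hl : l ∈ L) (hyl : .e y ∈ l.tgt)
    (hd : (∃ a, l = .der a y) ∨ l = .weak y) : IsCut B L y := by
  refine ⟨hy, ⟨l, hl, hyl⟩, fun k hk hyk => ?_⟩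
  by_cases hlk : l = k
  · exact hlk ▸ hd
  · exact .inl (h.exponential_in y l hl k hk hyl hyk hlk).2

/-- Below an e-node at level `0` there is a cut, or the net below it is the translation of a term
without explicit substitutions at level `0`. -/
theorem CorrectNet.exists_cut_or_spine (h : CorrectNet B L r)
    (hbox : ∀ a x s, .par a x s ∈ L → ∃ t, Translates B t {x} (B a x s) s)
    (hz : .head z a o ∈ levelZero B L) :
    (∃ y, IsCut B L y ∧ Relation.TransGen (Step (correctionGraph B L)) (.e z) (.e y)) ∨
      ∃ t C, IsSpine B L C t z := by
  induction hn : (Node.e z : Node E M) using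
    (h.toIsFragment.wellFounded_step_swap h.acyclic).induction generalizing z a o with
  | _ n ih =>
  subst hn
  have ih := fun q hq {a' o'} (hz' : .head q a' o' ∈ levelZero B L) => ih (.e q) hq hz' rfl
  refine or_iff_not_imp_left.2 fun hcut => ?_
  have hzG := mem_correctionGraph_of_ne_par hz (by simp)
  have hza : Step (correctionGraph B L) (.e z) (.m a) := ⟨_, hzG, by simp, by simp⟩
  have arg : ∀ q, o = some q → ∃ t C, IsSpine B L C t q := by
    rintro q rfl
    have hstep : Step (correctionGraph B L) (.e z) (.e q) := ⟨_, hzG, by simp, by simp⟩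
    have hq : HasOut L (.e q) := by
      by_contra ho
      rcases h.conclusions q (mem_fv_iff.2 ⟨⟨_, hz.1, by simp⟩, ho⟩) _ hz.1 (by simp) with
        ⟨b, hb⟩ | hb
      all_goals simp at hb
    obtain ⟨a', o', hq'⟩ := h.exists_head_of_mem_tgt (y := q) hz (by simp) (by simp) hq
    refine (ih q hstep hq').resolve_left ?_
    rintro ⟨y, hy, hqy⟩
    exact hcut ⟨y, hy, .head hstep hqy⟩
  obtain ⟨k, hk, hak⟩ := h.hasOut_m (a := a) ⟨_, hz.1, .inr (by simp)⟩
  have hk0 := h.levelZero_of_m hz (by simp) hk hak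
  cases k with
  | bang x b => simp at hak
  | tens x b y => simp at hak
  | weak x => simp at hak
  | square b T => exact absurd hk (h.labels b T)
  | der b y =>
    obtain rfl : a = b := by simpa using hak
    have hyL : y ∈ fv L := by
      refine mem_fv_iff.2 ⟨⟨_, hk, by simp⟩, fun ho => hcut ⟨y, ?_, .tail (.single hza) ?_⟩⟩
      · exact h.isCut_of_mem_tgt (h.exists_head_of_mem_tgt hk0 (by simp) rfl ho) hk rfl
          (.inl ⟨_, rfl⟩)
      · exact ⟨_, mem_correctionGraph_of_ne_par hk0 (by simp), by simp, by simp⟩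
    cases o with
    | none => exact ⟨_, _, .head_der hz hk0 hyL⟩
    | some q =>
      obtain ⟨t, C, hC⟩ := arg q rfl
      exact ⟨_, _, .head_der_app h hz hk0 hyL hC⟩
  | par b x s =>
    obtain rfl : a = b := by simpa using hak
    have hfv : ∀ y ∈ fv (B a x s), y ≠ x → y ∈ fv L := by
      intro y hy hyx
      obtain ⟨l, hl, hyl⟩ := (mem_fv_iff.1 hy).1
      have hlL := h.subnet _ _ _ hk hl
      refine mem_fv_iff.2 ⟨⟨l, hlL, hyl⟩, fun ho => hcut ⟨y, ?_, .tail (.single hza) ?_⟩⟩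
      · exact h.isCut_of_mem_tgt (h.exists_head_of_mem_fv_box hk0 hy hyx ho) hlL hyl
          ((h.box_correctNet hk).conclusions y hy l hl hyl)
      · exact ⟨_, square_mem_correctionGraph hk0, by simp, y, ⟨hy, hyx⟩, rfl⟩
    obtain ⟨t, ht⟩ := hbox _ _ _ hk
    cases o with
    | none => exact ⟨_, _, .head_par h hz hk0 ht hfv⟩
    | some q =>
      obtain ⟨t', C, hC⟩ := arg q rfl
      exact ⟨_, _, .head_par_app h hz hk0 ht hfv hC⟩

end Spines

section Sequentialization

variable {E M : Type*} {B : M → E → E → Set (Link E M)} {C L : Set (Link E M)}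
  {r x y z : E} {u : Node E M} {t : Term E}

open Hyper

/-! ### Removing a part of a correct net -/

/-- Removing a set `C` of links that contains all links at its m-nodes, is compatible with boxes
and leaves behind no new sources. -/
theorem CorrectNet.sdiff (h : CorrectNet B L r)
    (hm : ∀ a, .m a ∈ nodes C → ∀ l ∈ L, .m a ∈ l.src ∨ .m a ∈ l.tgt → l ∈ C)
    (hbox : ∀ a x s, .par a x s ∈ L → .par a x s ∉ C → ∀ l ∈ B a x s, l ∉ C)
    (hboxC : ∀ a x s, .par a x s ∈ C → B a x s ⊆ C)
    (hin : ∀ y, .e y ∈ nodes (L \ C) → HasIn L (.e y) → HasIn (L \ C) (.e y))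
    (hr : .e r ∈ nodes (L \ C))
    (hcon : ∀ y ∈ fv (L \ C), ∀ l ∈ L \ C, .e y ∈ l.tgt → (∃ a, l = .der a y) ∨ l = .weak y) :
    CorrectNet B (L \ C) r where
  finite := h.finite.subset Set.sdiff_subset
  labels a T hl := h.labels a T hl.1
  multiplicative a ha := by
    have hl : ∀ l ∈ L, .m a ∈ l.src ∨ .m a ∈ l.tgt → l ∈ L \ C := by
      obtain ⟨k, hk, hak⟩ := ha
      exact fun l hl hal => ⟨hl, fun hlC => hk.2 (hm a ⟨l, hlC, hal⟩ k hk.1 hak)⟩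
    obtain ⟨⟨i, hi, hi'⟩, ⟨j, hj, hj'⟩⟩ := h.multiplicative a (nodes_mono Set.sdiff_subset ha)
    exact ⟨⟨i, ⟨hl i hi.1 (.inr hi.2), hi.2⟩, fun k hk => hi' k ⟨hk.1.1, hk.2⟩⟩,
      ⟨j, ⟨hl j hj.1 (.inl hj.2), hj.2⟩, fun k hk => hj' k ⟨hk.1.1, hk.2⟩⟩⟩
  exponential_out x l hl k hk := h.exponential_out x l hl.1 k hk.1
  exponential_in x l hl k hk := h.exponential_in x l hl.1 k hk.1
  box_net a x s hp := h.box_net a x s hp.1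
  box_correct a x s hp := h.box_correct a x s hp.1
  border a x s hp := h.border a x s hp.1
  nesting a x s b y q hp hq := h.nesting a x s b y q hp.1 hq.1
  internal_closure a x s hp z hz l hl := h.internal_closure a x s hp.1 z hz l hl.1
  subnet a x s hp l hl := ⟨h.subnet a x s hp.1 hl, hbox a x s hp.1 hp.2 l hl⟩
  source x := by
    constructor
    · rintro ⟨hx, hi⟩
      exact h.eq_root (nodes_mono Set.sdiff_subset hx) fun hi' => hi (hin x hx hi')
    · rintro rfl
      exact ⟨hr, fun hi => h.not_hasIn_root (hi.mono Set.sdiff_subset)⟩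
  conclusions := hcon
  acyclic := by
    have h0 : levelZero B (L \ C) ⊆ levelZero B L := fun l ⟨hl, hl'⟩ => ⟨hl.1, fun a x s hp hlb => by
      by_cases hpC : .par a x s ∈ C
      · exact hl.2 (hboxC a x s hpC hlb)
      · exact hl' a x s ⟨hp, hpC⟩ hlb⟩
    refine Acyclic.mono ?_ h.acyclic
    rintro l (⟨hl, hl'⟩ | ⟨a, x, s, hp, rfl⟩)
    exacts [mem_correctionGraph_of_ne_par (h0 hl) hl', square_mem_correctionGraph (h0 hp)]

theorem CorrectNet.sdiff_weak (h : CorrectNet B L r) (hw : .weak y ∈ L) (hy : y ∈ fv L) :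
    CorrectNet B (L \ {.weak y}) r := by
  have hsrc : ∀ {u}, HasOut L u → HasOut (L \ {.weak y}) u := by
    rintro u ⟨l, hl, hu⟩
    refine ⟨l, ⟨hl, ?_⟩, hu⟩
    rintro rfl
    simp at hu
  refine h.sdiff ?_ ?_ (by simp) ?_ (hsrc h.hasOut_root).mem_nodes ?_
  · rintro a ⟨l, rfl, ha⟩
    simp at ha
  · rintro a x s hp - l hl rfl
    refine (h.border _ _ _ hp).2 y ?_ ?_ hl
    · exact mem_fv_of_subset (h.subnet _ _ _ hp) hy ⟨_, hl, .inr rfl⟩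
    · rintro rfl
      exact hy.2 ⟨_, hp, .inr rfl⟩
  · rintro z hz ⟨l, hl, hzl⟩
    by_cases hlw : l = .weak y
    · subst hlw
      obtain rfl : z = y := by simpa using hzl
      exact (mem_nodes_iff.1 hz).resolve_left fun ho => hy.2 (ho.mono Set.sdiff_subset)
    · exact ⟨l, ⟨hl, hlw⟩, hzl⟩
  · exact fun z hz l hl => h.conclusions z ⟨nodes_mono Set.sdiff_subset hz.1,
      fun ho => hz.2 (hsrc ho)⟩ l hl.1

namespace IsSpine

/-- The rest of the net meets the subnet of a spine in its root and in free variables only. -/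
theorem inter (hC : IsSpine B L C t z) (h : CorrectNet B L r) (hu : u ∈ nodes (L \ C))
    (huC : u ∈ nodes C) : u = .e z ∨ ∃ y, u = .e y ∧ y ∈ fv C := by
  obtain ⟨k, ⟨hk, hkC⟩, huk⟩ := hu
  have huk : u ∈ k.tgt :=
    huk.resolve_left fun huk => hkC (hC.mem_of_src h.toIsFragment huC hk huk)
  cases u with
  | m a => exact absurd (hC.mem_of_tgt_m h.toIsFragment huC hk huk) hkC
  | e y =>
    by_cases ho : HasOut C (.e y)
    · by_cases hi : HasIn C (.e y)
      · exact absurd (hC.closed y hi ho k hk huk) hkC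
      · exact .inl (congrArg _ (hC.correctNet.eq_root huC hi))
    · exact .inr ⟨y, rfl, huC, ho⟩

/-- Removing the subnet of a spine creates no new source. -/
theorem hasIn_rest (hC : IsSpine B L C t z) (h : CorrectNet B L r) (hz : HasIn L (.e z))
    (hy : .e y ∈ nodes (L \ C)) (hi : HasIn L (.e y)) : HasIn (L \ C) (.e y) := by
  obtain ⟨l, hl, hyl⟩ := hi
  by_cases hlC : l ∈ C
  · rcases hC.inter h hy ⟨l, hlC, .inr hyl⟩ with he | ⟨_, he, hyC⟩
    · cases he
      exact absurd ⟨l, hlC, hyl⟩ hC.correctNet.not_hasIn_root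
    · cases he
      exact (mem_nodes_iff.1 hy).resolve_left
        fun ho => (hC.fv_subset hyC).2 (ho.mono Set.sdiff_subset)
  · exact ⟨l, ⟨hl, hlC⟩, hyl⟩

theorem root_mem_fv_rest (hC : IsSpine B L C t z) (h : CorrectNet B L r) (hz : HasIn L (.e z)) :
    z ∈ fv (L \ C) := by
  obtain ⟨l, hl, hzl⟩ := hz
  refine mem_fv_iff.2 ⟨⟨l, ⟨hl, fun hlC => hC.correctNet.not_hasIn_root ⟨l, hlC, hzl⟩⟩, hzl⟩, ?_⟩
  rintro ⟨k, hk, hzk⟩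
  exact hk.2 (hC.mem_of_src h.toIsFragment hC.correctNet.root_mem hk.1 hzk)

theorem mem_fv_or_of_rest (hC : IsSpine B L C t z) (h : CorrectNet B L r)
    (hy : y ∈ fv (L \ C)) : y ∈ fv L ∨ y = z := by
  refine or_iff_not_imp_right.2 fun hyz =>
    ⟨nodes_mono Set.sdiff_subset hy.1, fun ⟨l, hl, hyl⟩ => ?_⟩
  have hlC : l ∈ C := by_contra fun hlC => hy.2 ⟨l, ⟨hl, hlC⟩, hyl⟩
  rcases hC.inter h hy.1 ⟨l, hlC, .inl hyl⟩ with he | ⟨_, he, hyC⟩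
  · cases he
    exact hyz rfl
  · cases he
    exact hyC.2 ⟨l, hlC, hyl⟩

/-- The rest of the net, after the spine of a cut has been removed, is a correct net. -/
theorem sdiff (hC : IsSpine B L C t z) (h : CorrectNet B L r) (hz : IsCut B L z) :
    CorrectNet B (L \ C) r := by
  refine h.sdiff ?_ ?_ hC.correctNet.subnet (fun y => hC.hasIn_rest h hz.2.1) ?_ ?_
  · rintro a ha l hl (hal | hal)
    exacts [hC.mem_of_src h.toIsFragment ha hl hal, hC.mem_of_tgt_m h.toIsFragment ha hl hal]
  · intro a x s hp hpC l hl hlC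
    obtain ⟨b, y, q, hq, hsub⟩ := h.exists_outer hp
    have hqC := hC.par_mem_of_mem_box h.toIsFragment hq (hsub hl) hlC
    rcases h.par_mem_box hp hq.1 hsub with hpq | ⟨rfl, rfl, rfl⟩
    · exact hpC (hC.correctNet.subnet _ _ _ hqC hpq)
    · exact hpC hqC
  · obtain ⟨l, hl, hrl⟩ := h.hasOut_root
    refine ⟨l, ⟨hl, fun hlC => ?_⟩, .inl hrl⟩
    obtain rfl := hC.correctNet.eq_root ⟨l, hlC, .inl hrl⟩
      fun hi => h.not_hasIn_root (hi.mono hC.subset)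
    exact h.not_hasIn_root hz.2.1
  · intro y hy l hl hyl
    rcases hC.mem_fv_or_of_rest h hy with hy' | rfl
    exacts [h.conclusions y hy' l hl.1 hyl, hz.2.2 l hl.1 hyl]

/-- Without free weakenings and without cuts, the spine of the root is the whole net: by induction
along the correction graph, it contains every link at level `0`. -/
theorem eq_of_no_cut (hC : IsSpine B L C t r) (h : CorrectNet B L r)
    (hw : freeWeakenings L = ∅) (hcut : ∀ z, ¬ IsCut B L z) : C = L := by
  have key : ∀ z a o, .head z a o ∈ levelZero B L → .head z a o ∈ C := by
    intro z a o hz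
    induction hn : (Node.e z : Node E M) using
      (h.toIsFragment.wellFounded_step h.acyclic).induction generalizing z a o with
    | _ n ih =>
    subst hn
    by_cases hzr : z = r
    · subst hzr
      exact hC.mem_of_src h.toIsFragment hC.correctNet.root_mem hz.1 (by simp)
    · have hi : HasIn L (.e z) := by
        by_contra hi
        exact hzr (h.eq_root ⟨_, hz.1, .inl (by simp)⟩ hi)
      have : ∃ k ∈ L, .e z ∈ k.tgt ∧ ¬ ((∃ a, k = .der a z) ∨ k = .weak z) := by
        by_contra! hc
        exact hcut z ⟨⟨a, o, hz⟩, hi, hc⟩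
      obtain ⟨k, hk, hzk, hnk⟩ := this
      cases k with
      | bang x b => simp at hzk
      | square b T => exact absurd hk (h.labels b T)
      | der b y => simp at hzk; simp [hzk] at hnk
      | weak y => simp at hzk; simp [hzk] at hnk
      | par b x s =>
        obtain rfl : z = s := by simpa using hzk
        obtain ⟨j, hj, hzj⟩ := h.hasOut_box_root hk
        have := h.out_unique (h.subnet _ _ _ hk hj) hz.1 hzj (by simp)
        exact absurd (this ▸ hj) (hz.2 _ _ _ hk)
      | tens y b z' =>
        obtain rfl : z = z' := by simpa using hzk
        have hk0 : .tens y b z ∈ levelZero B L := by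
          refine ⟨hk, fun c x s hp hkb => ?_⟩
          have ho : HasOut (B c x s) (.e z) := by
            by_contra ho
            rcases (h.box_correctNet hp).conclusions z (mem_fv_iff.2 ⟨⟨_, hkb, hzk⟩, ho⟩) _ hkb hzk
              with ⟨b, hb⟩ | hb
            all_goals cases hb
          obtain ⟨j, hj, hzj⟩ := ho
          have := h.out_unique (h.subnet _ _ _ hp hj) hz.1 hzj (by simp)
          exact hz.2 _ _ _ hp (this ▸ hj)
        have hkC : .tens y b z ∈ C := ih (.e y)
          ⟨_, mem_correctionGraph_of_ne_par hk0 (by simp), rfl, hzk⟩ y b (some z) hk0 rfl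
        exact hC.mem_of_src h.toIsFragment ⟨_, hkC, .inr hzk⟩ hz.1 (by simp)
  have out : ∀ a, ∀ k ∈ levelZero B L, .m a ∈ k.src → k ∈ C := by
    intro a k hk hak
    obtain ⟨j, hj, haj⟩ := h.hasIn_m ⟨k, hk.1, .inl hak⟩
    -- An incoming link in a box would put its m-node, hence `k`, into the box.
    have hj0 : j ∈ levelZero B L := by
      refine ⟨hj, fun b x s hp hjb => ?_⟩
      obtain ⟨i, hi, hai⟩ := (h.box_fragment hp).hasOut_m ⟨j, hjb, .inr haj⟩
      have := h.out_unique (h.subnet _ _ _ hp hi) hk.1 hai hak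
      exact hk.2 _ _ _ hp (this ▸ hi)
    have : ∃ z o, j = .head z a o := by
      cases j with
      | bang z b => exact ⟨z, none, by simpa [Link.head, eq_comm] using haj⟩
      | tens z b y => exact ⟨z, some y, by simpa [Link.head, eq_comm] using haj⟩
      | der b y => simp at haj
      | weak y => simp at haj
      | par b y s => simp at haj
      | square b T => simp at haj
    obtain ⟨z, o, rfl⟩ := this
    exact hC.mem_of_src h.toIsFragment ⟨_, key z a o hj0, .inr (by simp)⟩ hk.1 hak
  refine hC.subset.antisymm fun l hl => ?_
  rcases h.levelZero_or_outer hl with hl0 | ⟨a, x, s, hp, hlb⟩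
  · cases l with
    | bang z a => exact key z a none hl0
    | tens z a q => exact key z a (some q) hl0
    | der a y => exact out a _ hl0 rfl
    | par a x s => exact out a _ hl0 (.inl rfl)
    | square a T => exact absurd hl (h.labels a T)
    | weak y =>
      exfalso
      by_cases ho : HasOut L (.e y)
      · exact hcut y (h.isCut_of_mem_tgt (h.exists_head_of_mem_tgt hl0 (by simp) rfl ho) hl rfl
          (.inr rfl))
      · exact Set.eq_empty_iff_forall_notMem.1 hw y ⟨hl, mem_fv_iff.2 ⟨⟨_, hl, rfl⟩, ho⟩⟩
  · exact hC.correctNet.subnet _ _ _ (out a _ hp (.inl rfl)) hlb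

end IsSpine

/-! ### Sequentialization -/

/-- Turns the free weakenings of a box into the variable of its `⅋`-link, whether or not this
variable is a weakening. -/
theorem Translates.singleton (ht : Translates B t (freeWeakenings L) L r) (hx : x ∈ fv L)
    (hw : ∀ y ∈ fv L, .weak y ∈ L → y = x) : Translates B t {x} L r := by
  by_cases hxw : .weak x ∈ L
  · have : freeWeakenings L = {x} := by
      ext y
      constructor
      · rintro ⟨h1, h2⟩
        exact hw y h2 h1
      · rintro rfl
        exact ⟨hxw, hx⟩
    rwa [this] at ht
  · have : freeWeakenings L = ∅ := by
      refine Set.eq_empty_iff_forall_notMem.2 fun y ⟨h1, h2⟩ => ?_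
      exact hxw (hw y h2 h1 ▸ h1)
    rw [this] at ht
    have hxt := hx
    rw [ht.spec.fv_eq, Set.union_empty] at hxt
    have := Translates.skip x r t ∅ L ht hxt
    rwa [Set.empty_union] at this

/-- Every correct net is the translation of a term. The induction on the number of links peels off
a free weakening, or else the lowest explicit substitution at level `0`. -/
theorem CorrectNet.exists_translates (h : CorrectNet B L r) :
    ∃ t, Translates B t (freeWeakenings L) L r := by
  induction hn : L.ncard using Nat.strong_induction_on generalizing L r with
  | _ n ih =>
  subst hn
  have hbox : ∀ a x s, .par a x s ∈ L → ∃ t, Translates B t {x} (B a x s) s := by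
    intro a x s hp
    have hlt : (B a x s).ncard < L.ncard := Set.ncard_lt_ncard
      ⟨h.subnet _ _ _ hp, fun hs => h.par_notMem_box hp (hs hp)⟩ h.finite
    obtain ⟨t, ht⟩ := ih _ hlt (h.box_correctNet hp) rfl
    refine ⟨t, ht.singleton (h.border _ _ _ hp).1 fun y hy hw => ?_⟩
    exact by_contra fun hyx => (h.border _ _ _ hp).2 y hy hyx hw
  by_cases hw : freeWeakenings L = ∅
  · by_cases hcut : ∃ z, IsCut B L z
    · -- A cut with no other cut below it.
      obtain ⟨z, hz, hmin⟩ := ((InvImage.wf (Node.e : E → Node E M)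
        (h.toIsFragment.wellFounded_step_swap h.acyclic).transGen)).has_min {z | IsCut B L z} hcut
      obtain ⟨a, o, hz0⟩ := hz.1
      obtain ⟨u, C, hC⟩ := (h.exists_cut_or_spine hbox hz0).resolve_left
        fun ⟨y, hy, hzy⟩ => hmin y hy (Relation.transGen_swap.2 hzy)
      have hK := hC.sdiff h hz
      obtain ⟨l, hl, hzl⟩ := hC.correctNet.hasOut_root
      have hlt : (L \ C).ncard < L.ncard := Set.ncard_lt_ncard
        ⟨Set.sdiff_subset, fun hs => (hs (hC.subset hl)).2 hl⟩ h.finite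
      obtain ⟨t, ht⟩ := ih _ hlt hK rfl
      have ht := ht.singleton (hC.root_mem_fv_rest h hz.2.1) fun y hy hyw =>
        (hC.mem_fv_or_of_rest h hy).resolve_left fun hyL =>
          Set.eq_empty_iff_forall_notMem.1 hw y ⟨hyw.1, hyL⟩
      refine ⟨.sub t z u, ?_⟩
      have := Translates.sub z r t u _ _ ht hC.translates ?_
      · rwa [Set.sdiff_union_of_subset hC.subset, ← hw] at this
      · rintro v ⟨hv, hvC⟩
        rcases hC.inter h hv hvC with rfl | ⟨y, rfl, hy⟩
        · exact ⟨z, .inl rfl, rfl⟩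
        · have hyK := mem_fv_of_subset Set.sdiff_subset (hC.fv_subset hy) hv
          rw [ht.spec.fv_eq] at hyK
          rw [hC.translates.spec.fv_eq, Set.union_empty] at hy
          refine ⟨y, ?_, rfl⟩
          by_cases hyz : y = z
          · exact .inl hyz
          · exact .inr ⟨⟨hyK.resolve_right hyz, hyz⟩, hy⟩
    · push Not at hcut
      obtain ⟨l, hl, hrl⟩ := h.hasOut_root
      have hl0 : l ∈ levelZero B L :=
        ⟨hl, fun a x s hp hlb => h.root_notMem_box hp ⟨l, hlb, .inl hrl⟩⟩
      obtain ⟨a, o, rfl⟩ := IsFragment.exists_eq_head hrl (by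
        rintro a x s rfl
        obtain rfl : r = x := by simpa using hrl
        exact h.not_hasIn_root (h.var_hasIn hl))
      obtain ⟨t, C, hC⟩ := (h.exists_cut_or_spine hbox hl0).resolve_left
        fun ⟨y, hy, _⟩ => hcut y hy
      rw [hw, ← hC.eq_of_no_cut h hw hcut]
      exact ⟨t, hC.translates⟩
  · obtain ⟨y, hyw, hy⟩ := Set.nonempty_iff_ne_empty.2 hw
    have hlt : (L \ {.weak y}).ncard < L.ncard := Set.ncard_lt_ncard
      ⟨Set.sdiff_subset, fun hs => (hs hyw).2 rfl⟩ h.finite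
    obtain ⟨t, ht⟩ := ih _ hlt (h.sdiff_weak hyw hy) rfl
    have hfresh : .e y ∉ nodes (L \ {.weak y}) := by
      rintro ⟨l, hl, hyl | hyl⟩
      · exact hy.2 ⟨l, hl.1, hyl⟩
      · by_cases hlw : l = .weak y
        · exact hl.2 hlw
        · obtain ⟨-, b, hb⟩ := h.exponential_in y l hl.1 _ hyw hyl rfl hlw
          cases hb
    refine ⟨t, ?_⟩
    have := Translates.weak y r t _ _ ht
      (fun hyt => hfresh (ht.spec.fv_eq ▸ .inl hyt : y ∈ fv _).1) hfresh
    have hL : {.weak y} ∪ (L \ {.weak y}) = L :=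
      Set.union_sdiff_cancel (Set.singleton_subset_iff.2 hyw)
    have hX : freeWeakenings (L \ {.weak y}) ∪ {y} = freeWeakenings L := by
      ext z
      constructor
      · rintro (⟨h1, h2⟩ | rfl)
        · refine ⟨h1.1, nodes_mono Set.sdiff_subset h2.1, ?_⟩
          rintro ⟨l, hl, hzl⟩
          refine h2.2 ⟨l, ⟨hl, ?_⟩, hzl⟩
          rintro rfl
          simp at hzl
        · exact ⟨hyw, hy⟩
      · rintro ⟨h1, h2⟩
        by_cases hzy : z = y
        · exact .inr hzy
        · have h1' : .weak z ∈ L \ {.weak y} := ⟨h1, by simpa using hzy⟩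
          exact .inl ⟨h1', mem_fv_of_subset Set.sdiff_subset h2 ⟨_, h1', .inr rfl⟩⟩
    rwa [hL, hX] at this

end Sequentialization

theorem mainTheorem1 {E M : Type*} (G : PreNet E M) :
    (G.IsNet → G.IsCorrect →
      ∃ t : Term E, G.IsTranslation t G.freeWeakenings ∧ G.fv = t.fv ∪ G.freeWeakenings) ∧
    (∀ (t : Term E) (X : Set E), G.IsTranslation t X → G.IsNet ∧ G.IsCorrect) := by
  refine ⟨fun hN hC => ?_, fun t X ht => correctNet_iff.1 ht.spec.toCorrectNet⟩
  obtain ⟨t, ht⟩ := (correctNet_iff.2 ⟨hN, hC⟩).exists_translates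
  exact ⟨t, ht, ht.spec.fv_eq⟩
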